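/- Fix a prime $p$. For an abelian group $G$ and $x\in G$ let $\|x\|_p=\inf\{p^{-k}: k\in\mathbb N,\ x\in p^kG\}$ (so $\|x\|_p=p^{-k}$ for the largest $k$ with $x\in p^kG$, and $\|x\|_p=0$ if there is no largest one), with the $p$-adic metric $d(x,y)=\|x-y\|_p$. In the vocabulary $\{0,+,-\}$ let $\mathcal K_p$ be the class of all completions, in the $p$-adic metric, of direct sums $\mathbf Z_p^{(\kappa)}$ of copies of the $p$-adic integers ($\kappa$ any cardinal), considered as metric structures, and for $A,B\in\mathcal K_p$ put $A\preccurlyeq B$ if $A$ is a closed subgroup of $B$ that is pure (for all $n\in\mathbf Z$, an element of $A$ divisible by $n$ in $B$ is divisible by $n$ in $A$). A $\mathcal K$-embedding $f:A\to B$ is an isometric embedding of structures with $f(A)\preccurlyeq B$. Sequences $a$ in $A\in\mathcal K_p$ and $b$ in $B\in\mathcal K_p$ have the same Galois type over $\emptyset$ if there are $\mathcal K$-embeddings $f:A\to C$, $g:B\to C$, $C\in\mathcal K_p$, with $f(a)=g(b)$. For an infinite cardinal $\lambda$, a $\lambda$-monster is a model $M\in\mathcal K_p$ such that every $A\in\mathcal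 K_p$ of density character $<\lambda$ has a $\mathcal K$-embedding into $M$, and whenever two sequences in $M$ of length $<\lambda$ have the same Galois type over $\emptyset$, an isometric automorphism of $M$ maps the first to the second. Then: (1) $\mathcal K_p$ is a metric abstract elementary class: models are complete and their operations uniformly continuous; $\mathcal K_p$ and $\preccurlyeq$ are closed under isomorphism; $\preccurlyeq$ is a partial order on $\mathcal K_p$ that refines the substructure relation; if $(A_i)$ is a non-empty well-ordered $\preccurlyeq$-increasing chain in $\mathcal K_p$, then the completion $\overline{\bigcup_iA_i}$ belongs to $\mathcal K_p$, $A_j\preccurlyeq\overline{\bigcup_iA_i}$ for all $j$, and if $A_i\preccurlyeq B\in\mathcal K_p$ for all $i$ then $\overline{\bigcup_iA_i}\preccurlyeq B$; if $A\preccurlyeq C$, $B\preccurlyeq C$ and $A\subseteq B$ then $A\preccurlyeq B$; and there is a Löwenheim–Skolem number. The latter, i.e. the least cardinal $\mu$ such that for all $A\in\mathcal K_p$ and all $C\subseteq A$ there is $B\preccurlyeq A$ with $C\subseteq B$ and density character of $B$ at most $|C|+\mu$, is $\aleph_0$. (2) $\mathcal K_p$ has the joint embedding property and the amalgamation property. (3)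 $\mathcal K_p$ is homogeneous: if $A,B\in\mathcal K_p$ and $(a_i)_{i\in I}$ in $A$, $(b_i)_{i\in I}$ in $B$ are such that $(a_{i_k})_{k<n}$ and $(b_{i_k})_{k<n}$ have the same Galois type over $\emptyset$ for all $n<\omega$ and $i_0,\dots,i_{n-1}\in I$, then $(a_i)_{i\in I}$ and $(b_i)_{i\in I}$ have the same Galois type over $\emptyset$. For every $\lambda$ there is a $\lambda$-monster. Now let $\lambda$ be uncountable and let $M$ be a $\lambda$-monster. Let $t^g(a/A)=t^g(b/A)$ mean that an isometric automorphism of $M$ fixing $A$ pointwise maps $a$ to $b$. The only perturbations considered are the isometric isomorphisms, so for types $q,r$ of $n$-tuples over $A$, $d^p(q,r)=\inf\{d(a,b):a\models q,\ b\models r\}$. (4) (Perturbation property) For finite tuples $a,b$ of the same length, if $d^p(t^g(a/\emptyset),t^g(b/\emptyset))=0$ then $t^g(a/\emptyset)=t^g(b/\emptyset)$. (5) ($\omega$-$d^p$-stability) If $A\subseteq M$ has density character at most $\aleph_0$ (in particular, if $A$ is countable), then for each $n\ge1$ the set of types of $n$-tuples over $A$ has density character $\aleph_0$ in the $d^p$-topology.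 (6) $\mathcal K_p$ is simple: $a\downarrow_AA$ for all finite tuples $a$ in $M$ and all $A\subseteq M$ with $|A|<\lambda$. Here, all sets of parameters having cardinality $<\lambda$, a sequence $(b_i)_{i<\omega}$ of $m$-tuples is $C$-indiscernible if $t^g(b_{i_0}\dots b_{i_{n-1}}/C)=t^g(b_0\dots b_{n-1}/C)$ for all $n$ and $i_0<\dots<i_{n-1}$; $t^g(a/D)$ splits strongly over $C$ if there is a $C$-indiscernible sequence $(b_i)_{i<\omega}$ with $b_0,b_1\in D$ and $t^g(ab_0/C)\ne t^g(ab_1/C)$; $\kappa(\mathcal K_p)$ is the least cardinal $\kappa$ for which there are no finite tuple $a$ and increasing sequence of sets $A_i$ such that $t^g(a/A_{i+1})$ splits strongly over $A_i$ for all $i<\kappa$; and $a\downarrow_AB$ means that there is $C\subseteq A$ with $|C|<\kappa(\mathcal K_p)$ such that for all $D\supseteq A\cup B$ there is $b$ with $t^g(b/A\cup B)=t^g(a/A\cup B)$ such that $t^g(b/D)$ does not split strongly over $C$. -/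

import Mathlib

open Cardinal FirstOrder Set

universe u

namespace PadicMAEC

noncomputable section

/-! ### Metric structures and metric abstract elementary classes -/

/-- A metric structure: a first-order structure whose universe is a metric space. -/
structure MetricStr (L : FirstOrder.Language.{0, 0}) : Type (u + 1) where
  carrier : Type u
  [metric : MetricSpace carrier]
  [str : L.Structure carrier]

variable {L : FirstOrder.Language.{0, 0}}

instance : CoeSort (MetricStr.{u} L) (Type u) := ⟨MetricStr.carrier⟩
instance (M : MetricStr.{u} L) : MetricSpace M := M.metric
instance (M : MetricStr.{u} L) : L.Structure M := M.str

/-- A substructure with the induced metric and the induced structure. -/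
def MetricStr.ind (B : MetricStr.{u} L) (S : L.Substructure B) : MetricStr.{u} L := ⟨S⟩

/-- A class of metric structures with a relation `≼`: `Mem A` says that `A` is in the class, and
`Strong B S` says that the (structure induced on the) substructure `S` of `B` satisfies
`S ≼ B`. -/
structure MetricClass (L : FirstOrder.Language.{0, 0}) where
  Mem : MetricStr.{u} L → Prop
  Strong : (B : MetricStr.{u} L) → L.Substructure B → Prop

/-- The density character of a topological space. -/
def densityChar (X : Type u) [TopologicalSpace X] : Cardinal.{u} :=
  sInf {μ | ∃ D : Set X, Dense D ∧ #D = μ}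

/-- `f : A → B` is a `K`-embedding: an isometric embedding of structures with `f(A) ≼ B`. -/
def IsKEmb (K : MetricClass.{u} L) {A B : MetricStr.{u} L} (f : A ↪[L] B) : Prop :=
  Isometry f ∧ K.Strong B f.toHom.range

/-- Metric abstract elementary classes. The completion of the union of an increasing chain is
described as the model in which the images of the members of the chain are (compatibly)
`≼`-submodels with dense union; as the operations of models are uniformly continuous and models
are complete, this determines it up to isomorphism over the chain. -/
structure IsMAEC (K : MetricClass.{u} L) : Prop where
  /-- the models are complete -/
  complete : ∀ A, K.Mem A → CompleteSpace A
  /-- the operations of the models are uniformly continuous -/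
  uniformContinuous : ∀ A, K.Mem A → ∀ (n : ℕ) (f : L.Functions n),
    UniformContinuous (fun v : Fin n → A => FirstOrder.Language.Structure.funMap f v)
  /-- the class is closed under isomorphism -/
  mem_iso : ∀ (A B : MetricStr.{u} L) (e : A ≃[L] B), Isometry e → K.Mem A → K.Mem B
  /-- `≼` is closed under isomorphism -/
  strong_iso : ∀ (A B : MetricStr.{u} L) (e : A ≃[L] B), Isometry e →
    ∀ S : L.Substructure A, K.Strong A S → K.Strong B (S.map e.toHom)
  /-- `≼` is a relation on the class -/
  strong_mem : ∀ (B : MetricStr.{u} L) (S : L.Substructure B), K.Strong B S →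
    K.Mem B ∧ K.Mem (B.ind S)
  /-- `≼` is reflexive -/
  strong_refl : ∀ B, K.Mem B → K.Strong B ⊤
  /-- `≼` is transitive -/
  strong_trans : ∀ (C : MetricStr.{u} L) (S T : L.Substructure C), S ≤ T →
    K.Strong (C.ind T) (S.comap T.subtype.toHom) → K.Strong C T → K.Strong C S
  /-- completions of unions of `≼`-increasing chains -/
  chain : ∀ (ι : Type u) [LinearOrder ι] [WellFoundedLT ι] [Nonempty ι]
    (A : ι → MetricStr.{u} L) (f : ∀ i j, i ≤ j → (A i ↪[L] A j)),
    (∀ i, K.Mem (A i)) →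
    (∀ i j (h : i ≤ j), IsKEmb K (f i j h)) →
    (∀ i x, f i i le_rfl x = x) →
    (∀ i j k (hij : i ≤ j) (hjk : j ≤ k) x,
      f j k hjk (f i j hij x) = f i k (hij.trans hjk) x) →
    (∃ (U : MetricStr.{u} L) (g : ∀ i, A i ↪[L] U), K.Mem U ∧
      (∀ i, IsKEmb K (g i)) ∧
      (∀ i j (h : i ≤ j) x, g j (f i j h x) = g i x) ∧
      Dense (⋃ i, range (g i))) ∧
    (∀ (B : MetricStr.{u} L) (g : ∀ i, A i ↪[L] B), K.Mem B →
      (∀ i, IsKEmb K (g i)) →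
      (∀ i j (h : i ≤ j) x, g j (f i j h x) = g i x) →
      ∃ S : L.Substructure B, (S : Set B) = closure (⋃ i, range (g i)) ∧ K.Strong B S)
  /-- coherence -/
  coherence : ∀ (C : MetricStr.{u} L) (S T : L.Substructure C), K.Strong C S → K.Strong C T →
    S ≤ T → K.Strong (C.ind T) (S.comap T.subtype.toHom)
  /-- existence of a Löwenheim–Skolem number -/
  exists_ls : ∃ μ : Cardinal.{u}, ∀ A, K.Mem A → ∀ C : Set A,
    ∃ S : L.Substructure A, C ⊆ S ∧ K.Strong A S ∧ densityChar S ≤ #C + μ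

/-- `μ` is the Löwenheim–Skolem number of `K`. -/
def IsLSNumber (K : MetricClass.{u} L) (μ : Cardinal.{u}) : Prop :=
  IsLeast {μ : Cardinal.{u} | ∀ A, K.Mem A → ∀ C : Set A,
    ∃ S : L.Substructure A, C ⊆ S ∧ K.Strong A S ∧ densityChar S ≤ #C + μ} μ

/-- The joint embedding property. -/
def JEP (K : MetricClass.{u} L) : Prop :=
  ∀ A B, K.Mem A → K.Mem B → ∃ (C : MetricStr.{u} L) (f : A ↪[L] C) (g : B ↪[L] C),
    K.Mem C ∧ IsKEmb K f ∧ IsKEmb K g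

/-- The amalgamation property. -/
def AP (K : MetricClass.{u} L) : Prop :=
  ∀ (A B C : MetricStr.{u} L) (f : A ↪[L] B) (g : A ↪[L] C),
    K.Mem A → K.Mem B → K.Mem C → IsKEmb K f → IsKEmb K g →
    ∃ (D : MetricStr.{u} L) (f' : B ↪[L] D) (g' : C ↪[L] D),
      K.Mem D ∧ IsKEmb K f' ∧ IsKEmb K g' ∧ ∀ x, f' (f x) = g' (g x)

/-- The sequences `a` in `A` and `b` in `B` have the same Galois type over `∅`. -/
def SameGaloisType (K : MetricClass.{u} L) {ι : Type*} {A B : MetricStr.{u} L}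
    (a : ι → A) (b : ι → B) : Prop :=
  ∃ (C : MetricStr.{u} L) (f : A ↪[L] C) (g : B ↪[L] C),
    K.Mem C ∧ IsKEmb K f ∧ IsKEmb K g ∧ ∀ i, f (a i) = g (b i)

/-- Homogeneity: the Galois type of a sequence is determined by those of its finite
subsequences. -/
def Homogeneous (K : MetricClass.{u} L) : Prop :=
  ∀ (ι : Type u) (A B : MetricStr.{u} L), K.Mem A → K.Mem B → ∀ (a : ι → A) (b : ι → B),
    (∀ (n : ℕ) (s : Fin n → ι), SameGaloisType K (a ∘ s) (b ∘ s)) → SameGaloisType K a b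

/-- `M` is a monster model of `K` for sets of cardinality `< lam`: it is `lam`-universal and
strongly `lam`-homogeneous. -/
structure IsMonster (K : MetricClass.{u} L) (lam : Cardinal.{u}) (M : MetricStr.{u} L) :
    Prop where
  mem : K.Mem M
  universal : ∀ A, K.Mem A → densityChar A < lam → ∃ f : A ↪[L] M, IsKEmb K f
  homogeneous : ∀ ι : Type u, #ι < lam → ∀ a b : ι → M, SameGaloisType K a b →
    ∃ F : M ≃[L] M, Isometry F ∧ ∀ i, F (a i) = b i

/-! ### Galois types in a monster model -/

section Types

variable (M : MetricStr.{u} L)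

/-- Two sequences in `M` are identified if an automorphism of `M` fixing `A` pointwise maps the
first to the second. -/
def typeSetoid (A : Set M) (ι : Type) : Setoid (ι → M) where
  r a b := ∃ F : M ≃[L] M, Isometry F ∧ (∀ x ∈ A, F x = x) ∧ ∀ i, F (a i) = b i
  iseqv :=
    { refl := fun a => ⟨Language.Equiv.refl L M, isometry_id, fun _ _ => rfl, fun _ => rfl⟩
      symm := by
        rintro a b ⟨F, hF, hA, hab⟩
        refine ⟨F.symm, ?_, fun x hx => ?_, fun i => ?_⟩
        · intro x y
          rw [← hF, F.apply_symm_apply, F.apply_symm_apply]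
        · rw [← hA x hx, F.symm_apply_apply, hA x hx]
        · rw [← hab i, F.symm_apply_apply]
      trans := by
        rintro a b c ⟨F, hF, hA, hab⟩ ⟨G, hG, hA', hbc⟩
        refine ⟨G.comp F, hG.comp hF, fun x hx => ?_, fun i => ?_⟩
        · rw [Language.Equiv.comp_apply, hA x hx, hA' x hx]
        · rw [Language.Equiv.comp_apply, hab i, hbc i] }

/-- The Galois types over `A` of sequences in `M` indexed by `ι`. -/
def GType (A : Set M) (ι : Type) : Type u := Quotient (typeSetoid M A ι)

variable {M}

/-- The Galois type `t^g(a/A)`. -/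
def tg {ι : Type} (a : ι → M) (A : Set M) : GType M A ι := Quotient.mk (typeSetoid M A ι) a

/-- The distance `d^p(q, r) = inf {d(a, b) : a ⊨ q, b ⊨ r}` of Galois types of `n`-tuples, for the
system of perturbations that has only the isometric isomorphisms. -/
def dp {A : Set M} {n : ℕ} (q r : GType M A (Fin n)) : ℝ :=
  sInf {t | ∃ a b : Fin n → M, tg a A = q ∧ tg b A = r ∧ t = dist a b}

variable (M)

/-- The density character of the space of Galois types of `n`-tuples over `A`, in the
`d^p`-topology. -/
def typeDensityChar (A : Set M) (n : ℕ) : Cardinal.{u} :=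
  sInf {μ | ∃ T : Set (GType M A (Fin n)),
    (∀ q, ∀ ε > 0, ∃ r ∈ T, dp q r < ε) ∧ #T = μ}

/-- The perturbation property. -/
def PerturbationProperty : Prop :=
  ∀ (n : ℕ) (a b : Fin n → M), dp (tg a ∅) (tg b ∅) = 0 → tg a ∅ = tg b ∅

/-- `ω`-`d^p`-stability: the types over a separable set have density character `ℵ₀`. -/
def OmegaDPStable : Prop :=
  ∀ A : Set M, densityChar A ≤ ℵ₀ → ∀ n : ℕ, n ≠ 0 → typeDensityChar M A n = ℵ₀

variable {M}

/-- `b` is an `A`-indiscernible sequence (of `m`-tuples). -/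
def Indiscernible {m : ℕ} (b : ℕ → Fin m → M) (A : Set M) : Prop :=
  ∀ (n : ℕ) (s : Fin n → ℕ), StrictMono s →
    tg (fun k : Fin n × Fin m => b (s k.1) k.2) A = tg (fun k : Fin n × Fin m => b k.1 k.2) A

/-- `t^g(a/D)` splits strongly over `C`: there is a `C`-indiscernible sequence `(b_i)` with
`b_0, b_1 ∈ D` and `t^g(a b_0/C) ≠ t^g(a b_1/C)`. -/
def SplitsStrongly {n : ℕ} (a : Fin n → M) (D C : Set M) : Prop :=
  ∃ (m : ℕ) (b : ℕ → Fin m → M), Indiscernible b C ∧ (∀ j, b 0 j ∈ D) ∧ (∀ j, b 1 j ∈ D) ∧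
    tg (Sum.elim a (b 0)) C ≠ tg (Sum.elim a (b 1)) C

variable (M)

/-- There is a strongly splitting sequence of length `κ`: an increasing sequence of sets `A_i` and
a finite tuple `a` such that `t^g(a/A_{i+1})` splits strongly over `A_i` for all `i < κ`. Only sets
of cardinality `< lam` are considered, as always in a monster model. -/
def HasStronglySplittingSeq (lam κ : Cardinal.{u}) : Prop :=
  ∃ (n : ℕ) (a : Fin n → M) (A : Ordinal.{u} → Set M), Monotone A ∧
    ∀ i < κ.ord, #(A (Order.succ i)) < lam ∧ SplitsStrongly a (A (Order.succ i)) (A i)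

/-- `κ(K)`: the least cardinal `κ` such that there is no strongly splitting sequence of
length `κ`. -/
def kappa (lam : Cardinal.{u}) : Cardinal.{u} :=
  sInf {κ | ¬ HasStronglySplittingSeq M lam κ}

variable {M}

/-- The independence relation `a ↓_A B`. -/
def Indep (lam : Cardinal.{u}) {n : ℕ} (a : Fin n → M) (A B : Set M) : Prop :=
  ∃ C ⊆ A, #C < kappa M lam ∧ ∀ D : Set M, A ∪ B ⊆ D → #D < lam →
    ∃ b : Fin n → M, tg b (A ∪ B) = tg a (A ∪ B) ∧ ¬ SplitsStrongly b D C

variable (M)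

/-- Simplicity: `a ↓_A A` for all finite tuples `a` and all sets `A`. -/
def Simple (lam : Cardinal.{u}) : Prop :=
  ∀ (n : ℕ) (a : Fin n → M) (A : Set M), #A < lam → Indep lam a A A

end Types

/-! ### The class of completions of direct sums of copies of the `p`-adic integers -/

/-- The operation symbols of the vocabulary `{0, +, -}` of groups. -/
inductive GroupOp : ℕ → Type
  | zero : GroupOp 0
  | add : GroupOp 2
  | neg : GroupOp 1

/-- The vocabulary `{0, +, -}` of groups. -/
def groupLang : FirstOrder.Language.{0, 0} := ⟨GroupOp, fun _ => Empty⟩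

/-- The symbols `0, +, -` are interpreted by the operations of the abelian group `G`. -/
def IsGroupStr (G : Type u) [AddCommGroup G] [groupLang.Structure G] : Prop :=
  (∀ v : Fin 0 → G,
    FirstOrder.Language.Structure.funMap (L := groupLang) (n := 0) GroupOp.zero v = 0) ∧
  (∀ v : Fin 2 → G,
    FirstOrder.Language.Structure.funMap (L := groupLang) (n := 2) GroupOp.add v = v 0 + v 1) ∧
  (∀ v : Fin 1 → G,
    FirstOrder.Language.Structure.funMap (L := groupLang) (n := 1) GroupOp.neg v = - v 0)

/-- The `p`-adic norm `‖x‖_p = p ^ (-max {k | p ^ k divides x})`, with the value `0` if `x` has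
infinite height. -/
def padicNormOf (p : ℕ) {G : Type*} [AddCommGroup G] (x : G) : ℝ :=
  sInf {t | ∃ (k : ℕ) (y : G), p ^ k • y = x ∧ t = (p : ℝ) ^ (-(k : ℤ))}

/-- `N` is the completion, for the `p`-adic metric, of a direct sum of copies of the `p`-adic
integers. -/
def MemKp (p : ℕ) [Fact p.Prime] (N : MetricStr.{u} groupLang) : Prop :=
  ∃ _ : AddCommGroup N, IsGroupStr N ∧ IsTopologicalAddGroup N ∧ CompleteSpace N ∧
    ∃ (κ : Type u) (j : (κ →₀ ℤ_[p]) →+ N),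
      DenseRange j ∧ ∀ x y, dist (j x) (j y) = padicNormOf p (x - y)

/-- `S` is a pure subgroup of `B`. -/
def IsPure (B : MetricStr.{u} groupLang) (S : groupLang.Substructure B) : Prop :=
  ∃ _ : AddCommGroup B, IsGroupStr B ∧
    ∀ (n : ℤ), ∀ b ∈ S, (∃ a : B, n • a = b) → ∃ a ∈ S, n • a = b

/-- The class `K_p`, with `A ≼ B` if `A` is a closed pure subgroup of `B`. -/
def Kp (p : ℕ) [Fact p.Prime] : MetricClass.{u} groupLang where
  Mem := MemKp p
  Strong B S := MemKp p B ∧ MemKp p (B.ind S) ∧ IsClosed (S : Set B) ∧ IsPure B S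

end

end PadicMAEC

/-! The models in `Kp p` are exactly the complete, `p`-torsion-free normed groups whose norm is
their own `p`-adic norm (`IsPadic`, `exists_ofNormed`, `memKp_ofNormed`). Lifting an `𝔽_p`-basis of
`N / pN` gives a family whose integer combinations are dense and have the `p`-adic norm of their
coefficients (`IsPadic.exists_basis`, `PIndep.norm_zcomb`). Homomorphisms can therefore be
prescribed freely on it (`IsPBasis.exists_hom`).

Divisibility by `p ^ k` is the inequality `‖x‖ ≤ p⁻¹ ^ k`. Hence the image of an isometric
homomorphism is closed and pure, and the strong embeddings are just the isometric ones. Extending a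
basis of the image makes it a direct summand, and the norm is the maximum of the two components;
amalgamation follows.

A Galois type over `∅` amounts to the function `c ↦ ‖∑ c i • a i‖` (`sameGaloisType_iff`). It is
determined by finite subfamilies, which is homogeneity, and it varies continuously with the tuple,
which is the perturbation property. A group with a basis of more than `max lam ℵ₀` elements is a
monster: two isometric copies of a small group have complementary bases of equal size
(`IsPBasis.exists_automorphism`).

Over a small closed pure subgroup with projection `ρ`, a tuple is `ρ a + (a - ρ a)`, and the second
summand may be replaced by a copy that is free over any small larger set (`exists_free_hom`,
`norm_zcomb_free`). For stability, the first summand ranges over a separable group, and the copy can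
be taken in one fixed separable group. For simplicity, `ρ a` lies in the closed pure hull of a
countable set `C`, and the free copy does not split strongly over `C`. A countable `C` is allowed
because `∑ p ^ j • e (2 * j)`, with `e` independent modulo `p`, splits strongly `ω` times, so
`κ(K_p) > ℵ₀`. -/

namespace PadicMAEC

set_option linter.unusedSectionVars false

/-! ### The `p`-adic norm of an abelian group -/

section Norm

variable {p : ℕ} [hp : Fact p.Prime] {G H : Type*} [AddCommGroup G] [AddCommGroup H]

lemma one_lt_cast_prime (p : ℕ) [hp : Fact p.Prime] : (1 : ℝ) < p := by
  exact_mod_cast hp.out.one_lt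

lemma zpow_neg_eq_inv_pow (p k : ℕ) : (p : ℝ) ^ (-(k : ℤ)) = (p : ℝ)⁻¹ ^ k := by
  rw [zpow_neg, zpow_natCast, inv_pow]

lemma inv_prime_pos (p : ℕ) [hp : Fact p.Prime] : (0 : ℝ) < (p : ℝ)⁻¹ :=
  inv_pos.2 (zero_lt_one.trans (one_lt_cast_prime p))

lemma inv_prime_lt_one (p : ℕ) [hp : Fact p.Prime] : (p : ℝ)⁻¹ < 1 :=
  inv_lt_one_of_one_lt₀ (one_lt_cast_prime p)

lemma bddBelow_padicNormOf (p : ℕ) (x : G) :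
    BddBelow {t : ℝ | ∃ (k : ℕ) (y : G), p ^ k • y = x ∧ t = (p : ℝ) ^ (-(k : ℤ))} := by
  refine ⟨0, ?_⟩
  rintro _ ⟨k, y, -, rfl⟩
  positivity

lemma padicNormOf_le (p : ℕ) {x : G} {k : ℕ} {y : G} (h : p ^ k • y = x) :
    padicNormOf p x ≤ (p : ℝ)⁻¹ ^ k :=
  csInf_le (bddBelow_padicNormOf p x) ⟨k, y, h, (zpow_neg_eq_inv_pow p k).symm⟩

lemma exists_of_padicNormOf_lt {x : G} {r : ℝ} (h : padicNormOf p x < r) :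
    ∃ (k : ℕ) (y : G), p ^ k • y = x ∧ (p : ℝ)⁻¹ ^ k < r := by
  have hne : {t : ℝ | ∃ (k : ℕ) (y : G), p ^ k • y = x ∧ t = (p : ℝ) ^ (-(k : ℤ))}.Nonempty :=
    ⟨_, 0, x, by simp, rfl⟩
  obtain ⟨_, ⟨k, y, hy, rfl⟩, hr⟩ := exists_lt_of_csInf_lt hne h
  exact ⟨k, y, hy, zpow_neg_eq_inv_pow p k ▸ hr⟩

lemma padicNormOf_nonneg (p : ℕ) (x : G) : 0 ≤ padicNormOf p x := by
  refine Real.sInf_nonneg ?_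
  rintro _ ⟨k, y, -, rfl⟩
  positivity

lemma padicNormOf_le_one (p : ℕ) (x : G) : padicNormOf p x ≤ 1 := by
  simpa using padicNormOf_le p (x := x) (k := 0) (y := x) (by simp)

lemma exists_smul_of_le {x y : G} {k m : ℕ} (h : p ^ m • y = x) (hk : k ≤ m) :
    ∃ y, p ^ k • y = x :=
  ⟨p ^ (m - k) • y, by rw [smul_smul, ← pow_add, Nat.add_sub_cancel' hk, h]⟩

/-- The infimum need not be attained, but the candidate values are discrete away from `0`: a value
below `p⁻¹ ^ k` already has exponent at least `k + 1`. -/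
lemma padicNormOf_le_iff {x : G} {k : ℕ} :
    padicNormOf p x ≤ (p : ℝ)⁻¹ ^ k ↔ ∃ y, p ^ k • y = x := by
  refine ⟨fun h => ?_, fun ⟨y, hy⟩ => padicNormOf_le p hy⟩
  rcases k with _ | k
  · exact ⟨x, by simp⟩
  have h1 : (p : ℝ)⁻¹ ^ (k + 1) < (p : ℝ)⁻¹ ^ k :=
    pow_lt_pow_right_of_lt_one₀ (inv_prime_pos p) (inv_prime_lt_one p) (Nat.lt_succ_self k)
  obtain ⟨m, y, hy, hm⟩ := exists_of_padicNormOf_lt (h.trans_lt h1)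
  have := (pow_lt_pow_iff_right_of_lt_one₀ (inv_prime_pos p) (inv_prime_lt_one p)).1 hm
  exact exists_smul_of_le hy this

lemma padicNormOf_congr {x : G} {y : H}
    (h : ∀ k : ℕ, (∃ z, p ^ k • z = x) ↔ ∃ z, p ^ k • z = y) :
    padicNormOf p x = padicNormOf p y := by
  unfold padicNormOf
  congr 1
  ext t
  constructor
  · rintro ⟨k, z, hz, rfl⟩
    obtain ⟨w, hw⟩ := (h k).1 ⟨z, hz⟩
    exact ⟨k, w, hw, rfl⟩
  · rintro ⟨k, z, hz, rfl⟩
    obtain ⟨w, hw⟩ := (h k).2 ⟨z, hz⟩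
    exact ⟨k, w, hw, rfl⟩

/-- Homomorphisms preserve divisibility; hence they are automatically nonexpanding, and continuous,
for the `p`-adic norms. -/
lemma padicNormOf_map_le (f : G →+ H) (x : G) : padicNormOf p (f x) ≤ padicNormOf p x := by
  refine le_of_forall_gt_imp_ge_of_dense fun r hr => ?_
  obtain ⟨k, y, hy, hk⟩ := exists_of_padicNormOf_lt hr
  exact (padicNormOf_le p (k := k) (y := f y) (by rw [← hy, map_nsmul])).trans hk.le

lemma padicNormOf_zero : padicNormOf p (0 : G) = 0 := by
  refine le_antisymm (le_of_forall_gt_imp_ge_of_dense fun r hr => ?_) (padicNormOf_nonneg p _)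
  obtain ⟨k, hk⟩ := exists_pow_lt_of_lt_one hr (inv_prime_lt_one p)
  exact (padicNormOf_le p (k := k) (y := (0 : G)) (by simp)).trans hk.le

lemma padicNormOf_neg (x : G) : padicNormOf p (-x) = padicNormOf p x := by
  refine padicNormOf_congr fun k => ⟨?_, ?_⟩
  · rintro ⟨z, hz⟩
    exact ⟨-z, by rw [smul_neg, hz, neg_neg]⟩
  · rintro ⟨z, rfl⟩
    exact ⟨-z, by rw [smul_neg]⟩

lemma padicNormOf_add_le_max (x y : G) :
    padicNormOf p (x + y) ≤ max (padicNormOf p x) (padicNormOf p y) := by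
  refine le_of_forall_gt_imp_ge_of_dense fun r hr => ?_
  obtain ⟨k, x', rfl, hk⟩ := exists_of_padicNormOf_lt ((le_max_left _ _).trans_lt hr)
  obtain ⟨m, y', rfl, hm⟩ := exists_of_padicNormOf_lt ((le_max_right _ _).trans_lt hr)
  obtain ⟨z, hz⟩ := exists_smul_of_le (x := p ^ k • x') rfl (min_le_left k m)
  obtain ⟨w, hw⟩ := exists_smul_of_le (x := p ^ m • y') rfl (min_le_right k m)
  refine (padicNormOf_le p (k := min k m) (y := z + w) (by rw [smul_add, hz, hw])).trans ?_
  rcases min_choice k m with h | h <;> rw [h]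
  exacts [hk.le, hm.le]

lemma padicNormOf_prime_smul (ht : ∀ x : G, p • x = 0 → x = 0) (x : G) :
    padicNormOf p (p • x) = (p : ℝ)⁻¹ * padicNormOf p x := by
  have hp0 := inv_prime_pos p
  have hinj : ∀ a b : G, p • a = p • b → a = b := fun a b h =>
    sub_eq_zero.1 (ht _ (by rw [smul_sub, h, sub_self]))
  apply le_antisymm
  · rw [← div_le_iff₀' hp0]
    refine le_of_forall_gt_imp_ge_of_dense fun r hr => ?_
    obtain ⟨k, y, rfl, hk⟩ := exists_of_padicNormOf_lt hr
    rw [div_le_iff₀' hp0]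
    refine (padicNormOf_le p (k := k + 1) (y := y) (by rw [pow_succ', mul_smul])).trans ?_
    rw [pow_succ']
    gcongr
  · refine le_of_forall_gt_imp_ge_of_dense fun r hr => ?_
    obtain ⟨k, y, hy, hk⟩ := exists_of_padicNormOf_lt hr
    rcases k with _ | k
    -- A witness of exponent `0` only gives `1 < r`, which is enough since `p⁻¹ * ‖x‖ ≤ p⁻¹ < 1`.
    · have := padicNormOf_le_one p x
      have h1 := inv_prime_lt_one p
      simp only [pow_zero] at hk
      nlinarith
    · rw [pow_succ', mul_smul] at hy
      have := padicNormOf_le p (hinj _ _ hy)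
      refine le_trans ?_ hk.le
      rw [pow_succ']
      gcongr

end Norm

/-- An abelian group with the `p`-adic seminorm. -/
def WithPadic (_ : ℕ) (G : Type*) : Type _ := G

instance (p : ℕ) (G : Type*) [AddCommGroup G] : AddCommGroup (WithPadic p G) :=
  inferInstanceAs (AddCommGroup G)

noncomputable instance (p : ℕ) [Fact p.Prime] (G : Type*) [AddCommGroup G] :
    SeminormedAddCommGroup (WithPadic p G) :=
  AddGroupSeminorm.toSeminormedAddCommGroup
    { toFun := fun x : WithPadic p G => padicNormOf p (G := G) x
      map_zero' := padicNormOf_zero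
      add_le' := fun x y => (padicNormOf_add_le_max (G := G) x y).trans
        (max_le_add_of_nonneg (padicNormOf_nonneg p _) (padicNormOf_nonneg p _))
      neg' := fun x => padicNormOf_neg (G := G) x }

lemma WithPadic.norm_def {p : ℕ} [Fact p.Prime] {G : Type*} [AddCommGroup G]
    (x : WithPadic p G) : ‖x‖ = padicNormOf p (G := G) x := rfl

/-! ### Complete torsion-free `p`-adic groups -/

/-- `N` is `p`-torsion-free, normed by the `p`-adic norm, and complete. -/
structure IsPadic (p : ℕ) (N : Type*) [NormedAddCommGroup N] : Prop where
  complete : CompleteSpace N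
  eq_zero : ∀ x : N, p • x = 0 → x = 0
  norm_eq : ∀ x : N, ‖x‖ = padicNormOf p x

namespace IsPadic

variable {p : ℕ} [hp : Fact p.Prime] {N N' : Type*} [NormedAddCommGroup N] [NormedAddCommGroup N']

section

variable (hN : IsPadic p N)
include hN

lemma norm_le_iff {x : N} {k : ℕ} : ‖x‖ ≤ (p : ℝ)⁻¹ ^ k ↔ ∃ y, p ^ k • y = x := by
  rw [hN.norm_eq, padicNormOf_le_iff]

lemma norm_add_le_max (x y : N) : ‖x + y‖ ≤ max ‖x‖ ‖y‖ := by
  simp only [hN.norm_eq]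
  exact padicNormOf_add_le_max x y

lemma norm_sub_le_max (x y : N) : ‖x - y‖ ≤ max ‖x‖ ‖y‖ := by
  rw [sub_eq_add_neg, ← norm_neg y]
  exact hN.norm_add_le_max x (-y)

lemma norm_le_one (x : N) : ‖x‖ ≤ 1 := hN.norm_eq x ▸ padicNormOf_le_one p x

lemma norm_smul (x : N) : ‖p • x‖ = (p : ℝ)⁻¹ * ‖x‖ := by
  simp only [hN.norm_eq]
  exact padicNormOf_prime_smul hN.eq_zero x

lemma norm_pow_smul (k : ℕ) (x : N) : ‖p ^ k • x‖ = (p : ℝ)⁻¹ ^ k * ‖x‖ := by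
  induction k with
  | zero => simp
  | succ k ih => rw [pow_succ', mul_smul, hN.norm_smul, ih, pow_succ', mul_assoc]

lemma eq_zero_of_pow {k : ℕ} {x : N} (h : p ^ k • x = 0) : x = 0 := by
  have := hN.norm_pow_smul k x
  rw [h, norm_zero] at this
  have h2 := pow_pos (inv_prime_pos p) k
  rcases mul_eq_zero.1 this.symm with h' | h'
  · exact absurd h' h2.ne'
  · exact norm_eq_zero.1 h'

lemma pow_smul_injective (k : ℕ) : Function.Injective fun x : N => p ^ k • x := fun x y h =>
  sub_eq_zero.1 (hN.eq_zero_of_pow (k := k) (by rw [smul_sub, sub_eq_zero]; exact h))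

lemma exists_of_norm_lt_one {x : N} (h : ‖x‖ < 1) : ∃ y, p • y = x := by
  rw [hN.norm_eq] at h
  obtain ⟨k, y, rfl, hk⟩ := exists_of_padicNormOf_lt h
  rcases k with _ | k
  · simp at hk
  · exact ⟨p ^ k • y, by rw [pow_succ', mul_smul]⟩

end

lemma norm_map_le (hN : IsPadic p N) (hN' : IsPadic p N') (f : N →+ N') (x : N) :
    ‖f x‖ ≤ ‖x‖ := by
  rw [hN.norm_eq, hN'.norm_eq]
  exact padicNormOf_map_le f x

/-- Dividing a nonzero element repeatedly by `p` stops exactly at an element of norm one, so the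
norm records the largest exponent. -/
lemma of_norm [CompleteSpace N] (h1 : ∀ x : N, ‖p • x‖ = (p : ℝ)⁻¹ * ‖x‖)
    (h2 : ∀ x : N, ‖x‖ ≤ 1) (h3 : ∀ x : N, ‖x‖ < 1 → ∃ y, p • y = x) : IsPadic p N := by
  have hpow : ∀ (k : ℕ) (x : N), ‖p ^ k • x‖ = (p : ℝ)⁻¹ ^ k * ‖x‖ := by
    intro k x
    induction k with
    | zero => simp
    | succ k ih => rw [pow_succ', mul_smul, h1, ih, pow_succ', mul_assoc]
  refine ⟨inferInstance, fun x hx => ?_, fun x => le_antisymm ?_ ?_⟩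
  · have := h1 x
    rw [hx, norm_zero] at this
    rcases mul_eq_zero.1 this.symm with h | h
    · exact absurd h (inv_prime_pos p).ne'
    · exact norm_eq_zero.1 h
  · refine le_of_forall_gt_imp_ge_of_dense fun r hr => ?_
    obtain ⟨k, y, rfl, hk⟩ := exists_of_padicNormOf_lt hr
    rw [hpow]
    exact (mul_le_of_le_one_right (by positivity) (h2 y)).trans hk.le
  · by_cases hx : x = 0
    · rw [hx, padicNormOf_zero, norm_zero]
    obtain ⟨n, hn⟩ := exists_pow_lt_of_lt_one (norm_pos_iff.2 hx) (inv_prime_lt_one p)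
    classical
    have hex : ∃ k, ¬ ∃ y, p ^ k • y = x := ⟨n, fun ⟨y, hy⟩ => by
      rw [← hy, hpow] at hn
      exact absurd hn (not_lt.2 (mul_le_of_le_one_right (by positivity) (h2 y)))⟩
    have hspec := Nat.find_spec hex
    rcases hk : Nat.find hex with _ | k
    · rw [hk] at hspec
      exact absurd ⟨x, by simp⟩ hspec
    · have := Nat.find_min hex (m := k) (by omega)
      push Not at this
      obtain ⟨y, hy⟩ := this
      have hy1 : ‖y‖ = 1 := by
        refine le_antisymm (h2 y) (not_lt.1 fun hlt => hspec ?_)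
        obtain ⟨z, rfl⟩ := h3 y hlt
        exact ⟨z, by rw [hk, pow_succ, mul_smul, hy]⟩
      refine (padicNormOf_le p hy).trans ?_
      rw [← hy, hpow, hy1, mul_one]

/-- A complete normed group with a dense `p`-torsion-free subgroup on which the norm is the
`p`-adic norm of the subgroup. -/
lemma of_dense [CompleteSpace N] {G : Type*} [AddCommGroup G] (ht : ∀ x : G, p • x = 0 → x = 0)
    (j : G →+ N) (hj : DenseRange j) (hn : ∀ x, ‖j x‖ = padicNormOf p x) : IsPadic p N := by
  have hp0 := inv_prime_pos p
  have h1 : ∀ x : N, ‖p • x‖ = (p : ℝ)⁻¹ * ‖x‖ := fun x => by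
    refine hj.induction_on (p := fun x : N => ‖p • x‖ = (p : ℝ)⁻¹ * ‖x‖) x
      (isClosed_eq (by fun_prop) (by fun_prop)) fun g => ?_
    rw [← map_nsmul, hn, hn, padicNormOf_prime_smul ht]
  refine of_norm h1 (fun x => ?_) fun x hx => ?_
  · refine hj.induction_on (p := fun x : N => ‖x‖ ≤ 1) x
      (isClosed_le (by fun_prop) (by fun_prop)) fun g => ?_
    rw [hn]
    exact padicNormOf_le_one p g
  -- Multiplication by `p` is expanding up to the factor `p`, so `pN` is closed. The open unit ball
  -- lies in its closure, because elements of the dense subgroup of norm below one are divisible by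
  -- `p`.
  · have hanti : AntilipschitzWith p fun x : N => p • x := by
      refine AntilipschitzWith.of_le_mul_dist fun a b => ?_
      rw [dist_eq_norm, dist_eq_norm, ← smul_sub, h1]
      have : (p : ℝ) ≠ 0 := (zero_lt_one.trans (one_lt_cast_prime p)).ne'
      simp [this]
    have hcl : IsClosed (range fun x : N => p • x) :=
      hanti.isClosed_range (uniformContinuous_const_smul p)
    have hsub : x ∈ closure (range fun x : N => p • x) := by
      have hopen : IsOpen {y : N | ‖y‖ < 1} := isOpen_lt (by fun_prop) (by fun_prop)
      refine closure_mono ?_ (hj.open_subset_closure_inter hopen hx)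
      rintro _ ⟨hlt, g, rfl⟩
      rw [mem_ofPred_eq, hn] at hlt
      obtain ⟨k, y, rfl, hk⟩ := exists_of_padicNormOf_lt hlt
      rcases k with _ | k
      · simp at hk
      · exact ⟨j (p ^ k • y), by simp only [← map_nsmul, pow_succ', mul_smul]⟩
    rw [hcl.closure_eq] at hsub
    exact hsub

lemma prod (hN : IsPadic p N) (hN' : IsPadic p N') : IsPadic p (N × N') := by
  have := hN.complete
  have := hN'.complete
  refine of_norm (fun x => ?_) (fun x => ?_) fun x hx => ?_
  · rw [Prod.norm_def, Prod.norm_def, Prod.smul_fst, Prod.smul_snd, hN.norm_smul, hN'.norm_smul,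
      mul_max_of_nonneg _ _ (inv_prime_pos p).le]
  · exact max_le (hN.norm_le_one _) (hN'.norm_le_one _)
  · obtain ⟨y, hy⟩ := hN.exists_of_norm_lt_one ((le_max_left _ _).trans_lt hx)
    obtain ⟨z, hz⟩ := hN'.exists_of_norm_lt_one ((le_max_right _ _).trans_lt hx)
    exact ⟨(y, z), Prod.ext hy hz⟩

lemma completion {G : Type*} [AddCommGroup G] (ht : ∀ x : G, p • x = 0 → x = 0) :
    IsPadic p (UniformSpace.Completion (WithPadic p G)) :=
  of_dense (G := WithPadic p G) (p := p) ht (UniformSpace.Completion.toCompl (α := WithPadic p G))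
    UniformSpace.Completion.denseRange_coe fun x =>
      (UniformSpace.Completion.norm_coe (E := WithPadic p G) x)

/-- A closed subgroup that is closed under division by `p`. -/
lemma addSubgroup (hN : IsPadic p N) {S : AddSubgroup N} (hc : IsClosed (S : Set N))
    (hS : ∀ x : N, p • x ∈ S → x ∈ S) : IsPadic p S := by
  have := hN.complete
  have : CompleteSpace S := hc.isComplete.completeSpace_coe
  refine of_norm (fun x => ?_) (fun x => hN.norm_le_one _) fun x hx => ?_
  · exact hN.norm_smul (x : N)
  · obtain ⟨y, hy⟩ := hN.exists_of_norm_lt_one (x := (x : N)) hx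
    exact ⟨⟨y, hS y (hy ▸ x.2)⟩, Subtype.ext hy⟩

/-- If `p • x = f y`, then `‖y‖ = ‖p • x‖ < 1`, so `y` is itself divisible by `p`. Closedness comes
from completeness of the source. -/
lemma range (hN : IsPadic p N) (hN' : IsPadic p N') (f : N →+ N') (hf : ∀ x, ‖f x‖ = ‖x‖) :
    IsClosed (f.range : Set N') ∧ ∀ x : N', p • x ∈ f.range → x ∈ f.range := by
  have := hN.complete
  refine ⟨?_, ?_⟩
  · rw [AddMonoidHom.coe_range]
    exact (AddMonoidHomClass.isometry_of_norm f hf).isClosedEmbedding.isClosed_range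
  · rintro x ⟨y, hy⟩
    have : ‖y‖ < 1 := by
      rw [← hf, hy, hN'.norm_smul]
      calc (p : ℝ)⁻¹ * ‖x‖ ≤ (p : ℝ)⁻¹ :=
            mul_le_of_le_one_right (inv_prime_pos p).le (hN'.norm_le_one x)
        _ < 1 := inv_prime_lt_one p
    obtain ⟨z, rfl⟩ := hN.exists_of_norm_lt_one this
    refine ⟨z, ?_⟩
    have := hN'.pow_smul_injective 1
    refine this ?_
    simpa using hy

/-- A closed subgroup that is closed under division by `p` is pure. -/
lemma mem_of_zsmul_mem (hN : IsPadic p N) {S : AddSubgroup N} (hc : IsClosed (S : Set N))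
    (hS : ∀ x : N, p • x ∈ S → x ∈ S) {n : ℤ} (hn : n ≠ 0) {x : N} (hx : n • x ∈ S) : x ∈ S := by
  have hpow : ∀ (k : ℕ) (x : N), p ^ k • x ∈ S → x ∈ S := by
    intro k
    induction k with
    | zero => simp
    | succ k ih => exact fun x hx => hS x (ih _ (by rwa [pow_succ, mul_smul] at hx))
  have hfin : FiniteMultiplicity (p : ℤ) n :=
    Int.finiteMultiplicity_iff.2 ⟨by simpa using hp.out.ne_one, hn⟩
  obtain ⟨m, hm, hpm⟩ := hfin.exists_eq_pow_mul_and_not_dvd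
  have hmx : m • x ∈ S := by
    refine hpow (multiplicity (p : ℤ) n) _ ?_
    rw [hm, mul_smul] at hx
    rw [← natCast_zsmul]
    push_cast
    exact hx
  -- With `u * p ^ k + v * m = 1`, the element `v • m • x` of `S` is within `p⁻¹ ^ k` of `x`; as `S`
  -- is closed, division by the prime-to-`p` part `m` stays in `S`.
  have hcop : IsCoprime (p : ℤ) m :=
    (Int.prime_iff_natAbs_prime.2 (by simpa using hp.out)).coprime_iff_not_dvd.2 hpm
  rw [← SetLike.mem_coe, ← hc.closure_eq, Metric.mem_closure_iff]
  intro ε hε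
  obtain ⟨k, hk⟩ := exists_pow_lt_of_lt_one hε (inv_prime_lt_one p)
  obtain ⟨u, v, huv⟩ := hcop.pow_left (m := k)
  refine ⟨v • m • x, S.zsmul_mem hmx v, lt_of_le_of_lt ?_ hk⟩
  rw [dist_eq_norm, hN.norm_le_iff]
  refine ⟨u • x, ?_⟩
  have h1 : x = (u * (p : ℤ) ^ k + v * m) • x := by rw [huv, one_smul]
  rw [add_smul, mul_smul v m] at h1
  rw [sub_eq_of_eq_add h1, ← natCast_zsmul, smul_smul, mul_comm]
  push_cast
  rfl

/-- The closure of a subgroup that is closed under division by `p`. -/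
lemma topologicalClosure (hN : IsPadic p N) {S : AddSubgroup N}
    (hS : ∀ x : N, p • x ∈ S → x ∈ S) (x : N) (hx : p • x ∈ S.topologicalClosure) :
    x ∈ S.topologicalClosure := by
  rw [← SetLike.mem_coe, AddSubgroup.topologicalClosure_coe, Metric.mem_closure_iff] at hx ⊢
  intro ε hε
  have hp0 := inv_prime_pos p
  -- Distance below `1` makes `p • x - y` a multiple `p • z`; distance below `p⁻¹ * ε` then gives
  -- `‖z‖ < ε`. So `y = p • (x - z)`, and `x - z` is the approximation of `x` in `S`.
  obtain ⟨y, hy, hxy⟩ := hx (min 1 ((p : ℝ)⁻¹ * ε)) (by positivity)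
  rw [dist_eq_norm] at hxy
  obtain ⟨z, hz⟩ := hN.exists_of_norm_lt_one (hxy.trans_le (min_le_left _ _))
  have hy' : y = p • (x - z) := by rw [smul_sub, hz]; abel
  refine ⟨x - z, hS _ (hy' ▸ hy), ?_⟩
  have h2 := hxy.trans_le (min_le_right _ _)
  rw [← hz, hN.norm_smul] at h2
  rw [dist_eq_norm]
  simpa using lt_of_mul_lt_mul_left h2 hp0.le

end IsPadic

/-- Extension of a nonexpanding homomorphism from a dense subgroup. -/
lemma exists_extension {G W N : Type*} [AddCommGroup G] [SeminormedAddCommGroup W]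
    [NormedAddCommGroup N] [CompleteSpace N] (i : G →+ W) (hi : DenseRange i) (f : G →+ N)
    (hf : ∀ g, ‖f g‖ ≤ ‖i g‖) : ∃ F : W →+ N, Continuous F ∧ ∀ g, F (i g) = f g := by
  -- With the seminorm pulled back along `i`, the map `i` is a dense isometry and `f` is bounded, so
  -- extension of continuous linear maps over `ℤ` applies.
  let : SeminormedAddCommGroup G := SeminormedAddCommGroup.induced G W i
  have hni : ∀ g, ‖g‖ = ‖i g‖ := fun g => rfl
  have hii : Isometry i := AddMonoidHomClass.isometry_of_norm i fun g => (hni g).symm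
  let fL : G →L[ℤ] N := ⟨f.toIntLinearMap, AddMonoidHomClass.continuous_of_bound f 1 fun g => by
    rw [one_mul, hni]
    exact hf g⟩
  let iL : G →L[ℤ] W := ⟨i.toIntLinearMap, hii.continuous⟩
  refine ⟨(fL.extend iL).toLinearMap.toAddMonoidHom, (fL.extend iL).continuous, fun g => ?_⟩
  exact fL.extend_eq (e := iL) hi hii.isUniformInducing g

lemma norm_extension_eq {G W N : Type*} [AddCommGroup G] [SeminormedAddCommGroup W]
    [NormedAddCommGroup N] {i : G →+ W} (hi : DenseRange i) {f : G →+ N}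
    (hf : ∀ g, ‖f g‖ = ‖i g‖) {F : W →+ N} (hF : Continuous F) (hFi : ∀ g, F (i g) = f g) (w : W) :
    ‖F w‖ = ‖w‖ :=
  hi.induction_on (p := fun w => ‖F w‖ = ‖w‖) w (isClosed_eq (by fun_prop) (by fun_prop))
    fun g => by rw [hFi, hf]

/-! ### Integer combinations and `p`-independence -/

section Comb

variable {κ κ' G H : Type*} [AddCommGroup G] [AddCommGroup H]

/-- The integer combination `∑ i, c i • e i`. -/
noncomputable def zcomb (e : κ → G) : (κ →₀ ℤ) →+ G :=
  (Finsupp.linearCombination ℤ e).toAddMonoidHom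

@[simp]
lemma zcomb_single (e : κ → G) (i : κ) (n : ℤ) : zcomb e (Finsupp.single i n) = n • e i :=
  Finsupp.linearCombination_single ℤ n i

lemma map_zcomb (f : G →+ H) (e : κ → G) (c : κ →₀ ℤ) : f (zcomb e c) = zcomb (f ∘ e) c := by
  have : f.comp (zcomb e) = zcomb (f ∘ e) := by
    ext i
    simp
  exact DFunLike.congr_fun this c

lemma map_zcomb' (f : G →+ H) {e : κ → G} {e' : κ → H} (h : ∀ i, f (e i) = e' i) (c : κ →₀ ℤ) :
    f (zcomb e c) = zcomb e' c := by
  rw [map_zcomb]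
  congr
  exact funext h

lemma zcomb_add_family (e e' : κ → G) (c : κ →₀ ℤ) :
    zcomb (fun i => e i + e' i) c = zcomb e c + zcomb e' c := by
  have : zcomb (fun i => e i + e' i) = zcomb e + zcomb e' := by
    ext i
    simp
  exact DFunLike.congr_fun this c

lemma zcomb_mapDomain (e : κ' → G) (s : κ → κ') (c : κ →₀ ℤ) :
    zcomb e (c.mapDomain s) = zcomb (e ∘ s) c :=
  Finsupp.linearCombination_mapDomain ℤ s c

lemma mem_closure_range_iff_zcomb {e : κ → G} {x : G} :
    x ∈ AddSubgroup.closure (range e) ↔ ∃ c, zcomb e c = x := by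
  rw [← Submodule.span_int_eq_addSubgroupClosure, Submodule.mem_toAddSubgroup,
    ← Finsupp.range_linearCombination]
  rfl

lemma zcomb_mem_closure (e : κ → G) (c : κ →₀ ℤ) : zcomb e c ∈ AddSubgroup.closure (range e) :=
  mem_closure_range_iff_zcomb.2 ⟨c, rfl⟩

lemma zcomb_sumElim (e : κ → G) (e' : κ' → G) (c : κ ⊕ κ' →₀ ℤ) :
    zcomb (Sum.elim e e') c = zcomb e (Finsupp.sumFinsuppAddEquivProdFinsupp c).1 +
      zcomb e' (Finsupp.sumFinsuppAddEquivProdFinsupp c).2 := by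
  have : zcomb (Sum.elim e e') =
      ((zcomb e).comp (AddMonoidHom.fst _ _) + (zcomb e').comp (AddMonoidHom.snd _ _)).comp
        (Finsupp.sumFinsuppAddEquivProdFinsupp (α := κ) (β := κ') (M := ℤ)).toAddMonoidHom := by
    ext i
    rcases i with i | i <;>
      simp [Finsupp.sumFinsuppAddEquivProdFinsupp, Finsupp.sumFinsuppEquivProdFinsupp]
  rw [this]
  rfl

/-- The family `e` is independent modulo `p`. -/
def PIndep (p : ℕ) (e : κ → G) : Prop :=
  ∀ c : κ →₀ ℤ, (∃ y, p • y = zcomb e c) → ∃ c', p • c' = c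

/-- The family `e` generates the group modulo `p`. -/
def PSpan (p : ℕ) (e : κ → G) : Prop := ∀ x, ∃ c y, x = zcomb e c + p • y

variable {p : ℕ} [hp : Fact p.Prime]

lemma smul_injective_of (ht : ∀ x : G, p • x = 0 → x = 0) {x y : G} (h : p • x = p • y) :
    x = y :=
  sub_eq_zero.1 (ht _ (by rw [smul_sub, h, sub_self]))

/-- Independence removes one factor `p` from the coefficients, torsion-freeness cancels it in the
group, and induction handles `p ^ k`. -/
lemma PIndep.padicNormOf_zcomb (ht : ∀ x : G, p • x = 0 → x = 0) {e : κ → G} (he : PIndep p e)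
    (c : κ →₀ ℤ) : padicNormOf p (zcomb e c) = padicNormOf p c := by
  refine padicNormOf_congr fun k => ⟨?_, ?_⟩
  · induction k generalizing c with
    | zero => exact fun _ => ⟨c, by simp⟩
    | succ k ih =>
      rintro ⟨z, hz⟩
      rw [pow_succ', mul_smul] at hz
      obtain ⟨c', rfl⟩ := he c ⟨_, hz⟩
      rw [map_nsmul] at hz
      obtain ⟨d, rfl⟩ := ih c' ⟨z, smul_injective_of ht hz⟩
      exact ⟨d, by rw [pow_succ', mul_smul]⟩
  · rintro ⟨d, rfl⟩
    exact ⟨zcomb e d, by rw [map_nsmul]⟩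

lemma PIndep.comp {e : κ' → G} (he : PIndep p e) {s : κ → κ'} (hs : Function.Injective s) :
    PIndep p (e ∘ s) := by
  rintro c ⟨y, hy⟩
  rw [← zcomb_mapDomain] at hy
  obtain ⟨c', hc'⟩ := he _ ⟨y, hy⟩
  refine ⟨c'.comapDomain s hs.injOn, ?_⟩
  ext i
  have := DFunLike.congr_fun hc' (s i)
  rw [Finsupp.mapDomain_apply hs] at this
  rw [← this]
  simp

lemma PIndep.map {e : κ → G} (he : PIndep p e) (f : G →+ H)
    (hf : ∀ x, (∃ y, p • y = f x) → ∃ z, p • z = x) : PIndep p (f ∘ e) := by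
  rintro c hc
  rw [← map_zcomb] at hc
  exact he c (hf _ hc)

lemma finsupp_eq_zero_of_prime_smul {A : Type*} [AddCommGroup A] (hA : ∀ x : A, p • x = 0 → x = 0)
    (c : κ →₀ A) (h : p • c = 0) : c = 0 := by
  ext i
  exact hA _ (by simpa using DFunLike.congr_fun h i)

lemma int_eq_zero_of_prime_smul (x : ℤ) (h : p • x = 0) : x = 0 := by
  have := hp.out.ne_zero
  simpa [this] using h

lemma PSpan.pow {e : κ → G} (he : PSpan p e) (k : ℕ) (x : G) :
    ∃ c y, x = zcomb e c + p ^ k • y := by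
  induction k with
  | zero => exact ⟨0, x, by simp⟩
  | succ k ih =>
    obtain ⟨c, y, rfl⟩ := ih
    obtain ⟨d, z, rfl⟩ := he y
    refine ⟨c + p ^ k • d, z, ?_⟩
    rw [map_add, map_nsmul, smul_add, add_assoc, pow_succ, mul_smul]

/-- The reduction modulo `p` of the coefficients. -/
noncomputable def redCoeff (p : ℕ) (κ : Type*) : (κ →₀ ℤ) →+ (κ →₀ ZMod p) :=
  Finsupp.mapRange.addMonoidHom (Int.castAddHom (ZMod p))

lemma redCoeff_surjective (κ : Type*) : Function.Surjective (redCoeff p κ) := fun d => by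
  refine ⟨d.mapRange (fun x => (x.cast : ℤ)) (by simp), ?_⟩
  ext i
  simp [redCoeff]

lemma redCoeff_eq_zero_iff (c : κ →₀ ℤ) : redCoeff p κ c = 0 ↔ ∃ c', p • c' = c := by
  constructor
  · intro h
    refine ⟨c.mapRange (fun x => x / p) (by simp), ?_⟩
    ext i
    have h1 := DFunLike.congr_fun h i
    have h2 : ((c i : ℤ) : ZMod p) = 0 := by simpa [redCoeff] using h1
    have h3 := (ZMod.intCast_zmod_eq_zero_iff_dvd (c i) p).1 h2
    simpa using Int.mul_ediv_cancel' h3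
  · rintro ⟨c', rfl⟩
    ext i
    simp [redCoeff]

lemma map_zcomb_redCoeff {V : Type*} [AddCommGroup V] [Module (ZMod p) V] (q : G →+ V)
    (v : κ → G) (c : κ →₀ ℤ) :
    q (zcomb v c) = Finsupp.linearCombination (ZMod p) (q ∘ v) (redCoeff p κ c) := by
  have : q.comp (zcomb v) =
      (Finsupp.linearCombination (ZMod p) (q ∘ v)).toAddMonoidHom.comp (redCoeff p κ) := by
    ext i
    simp [redCoeff]
  exact DFunLike.congr_fun this c

/-- `V` plays the role of `N / pN`. Independence modulo `p` is linear independence of the images in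
`V`, so it suffices to extend to an `𝔽_p`-basis of `V` and lift the new vectors. -/
lemma PIndep.exists_extend_of_module {κ N V : Type u} [AddCommGroup N] {e : κ → N}
    (he : PIndep p e) [AddCommGroup V] [Module (ZMod p) V] (q : N →+ V)
    (hs : Function.Surjective q) (hq : ∀ x, q x = 0 ↔ ∃ y, p • y = x) :
    ∃ (κ' : Type u) (e' : κ' → N), PIndep p (Sum.elim e e') ∧ PSpan p (Sum.elim e e') := by
  have hli : LinearIndependent (ZMod p) (q ∘ e) := by
    rw [linearIndependent_iff]
    intro d hd
    obtain ⟨c, rfl⟩ := redCoeff_surjective κ d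
    rw [← map_zcomb_redCoeff, hq] at hd
    exact (redCoeff_eq_zero_iff c).2 (he c hd)
  let b := Module.Basis.sumExtend hli
  have hb : ∀ i, b (Sum.inl i) = q (e i) := fun i => by
    simp only [b, Module.Basis.sumExtend, Module.Basis.coe_reindex, Function.comp_apply,
      Module.Basis.extend_apply_self]
    have := Classical.decPred (· ∈ range (q ∘ e))
    exact congrArg Subtype.val (Equiv.Set.sumDiffSubset_apply_inl
      (hli.linearIndepOn_id.subset_extend (subset_univ _)) _)
  choose g hg using hs
  let e' : Module.Basis.sumExtendIndex hli → N := fun i => g (b (Sum.inr i))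
  have hbe : q ∘ Sum.elim e e' = b := by
    funext i
    rcases i with i | i
    · exact (hb i).symm
    · exact hg _
  refine ⟨_, e', fun c hc => ?_, fun x => ?_⟩
  · rw [← hq, map_zcomb_redCoeff (p := p), hbe] at hc
    exact (redCoeff_eq_zero_iff c).1 (linearIndependent_iff.1 b.linearIndependent _ hc)
  · obtain ⟨c, hc⟩ := redCoeff_surjective _ (b.repr (q x))
    have : q (x - zcomb (Sum.elim e e') c) = 0 := by
      rw [map_sub, map_zcomb_redCoeff (p := p), hbe, hc, b.linearCombination_repr, sub_self]
    obtain ⟨y, hy⟩ := (hq _).1 this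
    exact ⟨c, y, by rw [hy]; abel⟩

/-- Every `p`-independent family extends to a basis modulo `p`. -/
lemma PIndep.exists_extend {κ N : Type u} [AddCommGroup N] {e : κ → N} (he : PIndep p e) :
    ∃ (κ' : Type u) (e' : κ' → N), PIndep p (Sum.elim e e') ∧ PSpan p (Sum.elim e e') := by
  let P : AddSubgroup N := (nsmulAddMonoidHom (α := N) p).range
  have hP : ∀ x : N, p • x ∈ P := fun x => ⟨x, rfl⟩
  let inst : Module (ZMod p) (N ⧸ P) := QuotientAddGroup.zmodModule hP
  exact he.exists_extend_of_module (QuotientAddGroup.mk' P) (QuotientAddGroup.mk'_surjective P)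
    fun x => QuotientAddGroup.eq_zero_iff x

end Comb

/-! ### Bases -/

section Basis

variable {p : ℕ} [hp : Fact p.Prime] {N N' : Type*} [NormedAddCommGroup N] [NormedAddCommGroup N']
  {κ : Type*}

/-- A `p`-independent family with dense span. -/
def IsPBasis (p : ℕ) (e : κ → N) : Prop := PIndep p e ∧ DenseRange (zcomb e)

lemma PIndep.norm_zcomb (hN : IsPadic p N) {e : κ → N} (he : PIndep p e) (c : κ →₀ ℤ) :
    ‖zcomb e c‖ = padicNormOf p c := by
  rw [hN.norm_eq, he.padicNormOf_zcomb hN.eq_zero]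

/-- Expanding the remainder again and again leaves a remainder in `p ^ k W`, of norm at most `p⁻¹ ^
k`. -/
lemma PSpan.denseRange {W : Type*} [SeminormedAddCommGroup W]
    (hW : ∀ x : W, ‖x‖ = padicNormOf p x) {e : κ → W} (he : PSpan p e) :
    DenseRange (zcomb e) := by
  rw [Metric.denseRange_iff]
  intro x r hr
  obtain ⟨k, hk⟩ := exists_pow_lt_of_lt_one hr (inv_prime_lt_one p)
  obtain ⟨c, y, rfl⟩ := he.pow k x
  refine ⟨c, lt_of_le_of_lt ?_ hk⟩
  rw [dist_eq_norm, hW, padicNormOf_le_iff]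
  exact ⟨y, by abel⟩

lemma IsPadic.exists_extend_basis {N κ : Type u} [NormedAddCommGroup N] (hN : IsPadic p N)
    {e : κ → N} (he : PIndep p e) :
    ∃ (κ' : Type u) (e' : κ' → N), IsPBasis p (Sum.elim e e') := by
  obtain ⟨κ', e', h1, h2⟩ := he.exists_extend
  exact ⟨κ', e', h1, h2.denseRange hN.norm_eq⟩

lemma IsPadic.exists_basis {N : Type u} [NormedAddCommGroup N] (hN : IsPadic p N) :
    ∃ (κ : Type u) (e : κ → N), IsPBasis p e := by
  -- A basis is obtained by extending the empty family.
  obtain ⟨κ, e, h1, h2⟩ := hN.exists_extend_basis (κ := PEmpty.{u + 1}) (e := fun i => i.elim)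
    fun c _ => ⟨0, Subsingleton.elim _ _⟩
  refine ⟨_, _, h1, h2⟩

/-- No bound on `f` is needed: combinations of a basis have the norm of their coefficients, which is
the largest norm that a combination with these coefficients can have. -/
lemma IsPBasis.exists_hom (hN : IsPadic p N) (hN' : IsPadic p N') {e : κ → N}
    (he : IsPBasis p e) (f : κ → N') :
    ∃ F : N →+ N', Continuous F ∧ (∀ i, F (e i) = f i) ∧ (PIndep p f → ∀ x, ‖F x‖ = ‖x‖) := by
  have := hN'.complete
  obtain ⟨F, hF, hFe⟩ := exists_extension (zcomb e) he.2 (zcomb f) fun c => by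
    rw [he.1.norm_zcomb hN, hN'.norm_eq]
    exact padicNormOf_map_le (zcomb f) c
  refine ⟨F, hF, fun i => ?_, fun hf => norm_extension_eq he.2 (fun c => ?_) hF hFe⟩
  · simpa using hFe (Finsupp.single i 1)
  · rw [he.1.norm_zcomb hN, hf.norm_zcomb hN']

lemma surjective_of_norm_eq (hN : IsPadic p N) (hN' : IsPadic p N') (f : N →+ N')
    (hf : ∀ x, ‖f x‖ = ‖x‖) (hd : DenseRange f) : Function.Surjective f := by
  have h1 := (hN.range hN' f hf).1
  rw [AddMonoidHom.coe_range] at h1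
  rw [← range_eq_univ, ← h1.closure_eq]
  exact hd.closure_range

lemma IsPBasis.surjective (hN : IsPadic p N) (hN' : IsPadic p N') {e : κ → N'}
    (he : IsPBasis p e) (f : N →+ N') (hf : ∀ x, ‖f x‖ = ‖x‖) (h : ∀ i, ∃ x, f x = e i) :
    Function.Surjective f := by
  choose g hg using h
  refine surjective_of_norm_eq hN hN' f hf (he.2.mono ?_)
  rintro _ ⟨c, rfl⟩
  exact ⟨zcomb g c, map_zcomb' f hg c⟩

/-- The image of an isometric homomorphism is a direct summand. -/
lemma IsPadic.exists_leftInverse {A B : Type u} [NormedAddCommGroup A] [NormedAddCommGroup B]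
    (hA : IsPadic p A) (hB : IsPadic p B) (f : A →+ B) (hf : ∀ x, ‖f x‖ = ‖x‖) :
    ∃ ρ : B →+ A, ∀ x, ρ (f x) = x := by
  obtain ⟨κ, e, he⟩ := hA.exists_basis
  obtain ⟨κ', e', he'⟩ := hB.exists_extend_basis (e := f ∘ e) <|
    he.1.map f fun x ⟨y, hy⟩ => by
      obtain ⟨z, rfl⟩ := (hA.range hB f hf).2 y ⟨x, hy.symm⟩
      exact ⟨z, (AddMonoidHomClass.isometry_of_norm f hf).injective (by rw [map_nsmul, hy])⟩
  -- The projection sends `f (e i)` back to `e i` and kills the added basis vectors.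
  obtain ⟨ρ, hρ, hρe, -⟩ := he'.exists_hom hB hA (Sum.elim e 0)
  have hfc : Continuous f := (AddMonoidHomClass.isometry_of_norm f hf).continuous
  refine ⟨ρ, fun x => ?_⟩
  refine he.2.induction_on (p := fun x => ρ (f x) = x) x
    (isClosed_eq (hρ.comp hfc) continuous_id) fun c => ?_
  rw [map_zcomb f]
  exact map_zcomb' ρ (fun i => hρe (Sum.inl i)) c

/-- The decomposition `x = f (ρ x) + (x - f (ρ x))` is orthogonal: `ρ` is automatically
nonexpanding, and the norm is ultrametric. -/
lemma IsPadic.norm_eq_max {A B : Type*} [NormedAddCommGroup A] [NormedAddCommGroup B]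
    (hA : IsPadic p A) (hB : IsPadic p B) {f : A →+ B} (hf : ∀ x, ‖f x‖ = ‖x‖) (ρ : B →+ A)
    (x : B) : ‖x‖ = max ‖ρ x‖ ‖x - f (ρ x)‖ := by
  have h1 : ‖ρ x‖ ≤ ‖x‖ := hB.norm_map_le hA ρ x
  refine le_antisymm ?_ (max_le h1 ?_)
  · have := hB.norm_add_le_max (f (ρ x)) (x - f (ρ x))
    rwa [add_sub_cancel, hf] at this
  · exact (hB.norm_sub_le_max _ _).trans (max_le le_rfl (by rwa [hf]))

/-- Amalgamation of isometric homomorphisms. -/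
lemma IsPadic.exists_amalgam {A B C : Type u} [NormedAddCommGroup A] [NormedAddCommGroup B]
    [NormedAddCommGroup C] (hA : IsPadic p A) (hB : IsPadic p B) (f : A →+ B)
    (hf : ∀ x, ‖f x‖ = ‖x‖) (g : A →+ C) (hg : ∀ x, ‖g x‖ = ‖x‖) :
    ∃ (f' : B →+ C × B) (g' : C →+ C × B), (∀ x, ‖f' x‖ = ‖x‖) ∧ (∀ x, ‖g' x‖ = ‖x‖) ∧
      ∀ x, f' (f x) = g' (g x) := by
  obtain ⟨ρ, hρ⟩ := hA.exists_leftInverse hB f hf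
  -- `B` is the sum of `f A` and the kernel of `ρ`. The first summand is sent into `C` through `g`,
  -- the second is kept, and `C` is the first factor of the amalgam.
  refine ⟨(g.comp ρ).prod (AddMonoidHom.id B - f.comp ρ), AddMonoidHom.inl C B, fun x => ?_,
    fun x => ?_, fun x => ?_⟩
  · rw [hA.norm_eq_max hB hf ρ x, Prod.norm_def]
    simp [hg]
  · simp [Prod.norm_def]
  · simp [hρ]

end Basis

/-! ### Closed pure subgroups generated by a set -/

section Pcl

variable {p : ℕ} [hp : Fact p.Prime] {N N' : Type*} [NormedAddCommGroup N] [NormedAddCommGroup N']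
  {ι : Type*}

/-- The elements with a `p`-power multiple in the subgroup generated by `A`. -/
def hull (p : ℕ) (A : Set N) : AddSubgroup N where
  carrier := {x | ∃ k : ℕ, p ^ k • x ∈ AddSubgroup.closure A}
  zero_mem' := ⟨0, by simp⟩
  add_mem' := by
    rintro x y ⟨k, hk⟩ ⟨m, hm⟩
    refine ⟨k + m, ?_⟩
    rw [smul_add]
    refine add_mem ?_ ?_
    · rw [pow_add, mul_comm, mul_smul]
      exact nsmul_mem hk _
    · rw [pow_add, mul_smul]
      exact nsmul_mem hm _
  neg_mem' := by
    rintro x ⟨k, hk⟩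
    exact ⟨k, by rw [smul_neg]; exact neg_mem hk⟩

/-- The least closed pure subgroup that contains `A`. -/
def pcl (p : ℕ) (A : Set N) : AddSubgroup N := (hull p A).topologicalClosure

lemma closure_le_hull (A : Set N) : AddSubgroup.closure A ≤ hull p A := fun x hx =>
  ⟨0, by simpa using hx⟩

lemma hull_le_pcl (A : Set N) : hull p A ≤ pcl p A := AddSubgroup.le_topologicalClosure _

lemma closure_le_pcl (A : Set N) : AddSubgroup.closure A ≤ pcl p A :=
  (closure_le_hull A).trans (hull_le_pcl A)

lemma subset_pcl (A : Set N) : A ⊆ pcl p A := AddSubgroup.subset_closure.trans (closure_le_pcl A)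

lemma isClosed_pcl (A : Set N) : IsClosed (pcl p A : Set N) :=
  AddSubgroup.isClosed_topologicalClosure _

lemma pcl_pure (hN : IsPadic p N) (A : Set N) (x : N) (hx : p • x ∈ pcl p A) : x ∈ pcl p A := by
  refine hN.topologicalClosure (fun y hy => ?_) x hx
  obtain ⟨k, hk⟩ := hy
  exact ⟨k + 1, by rwa [pow_succ, mul_smul]⟩

lemma isPadic_pcl (hN : IsPadic p N) (A : Set N) : IsPadic p (pcl p A) :=
  hN.addSubgroup (isClosed_pcl A) (pcl_pure hN A)

lemma pcl_le {A : Set N} {S : AddSubgroup N} (hc : IsClosed (S : Set N))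
    (hS : ∀ x : N, p • x ∈ S → x ∈ S) (hA : A ⊆ S) : pcl p A ≤ S := by
  refine AddSubgroup.topologicalClosure_minimal _ ?_ hc
  rintro x ⟨k, hk⟩
  replace hk := (AddSubgroup.closure_le S).2 hA hk
  induction k with
  | zero => simpa using hk
  | succ k ih => exact ih (hS _ (by rwa [pow_succ', mul_smul] at hk))

lemma pcl_mono (hN : IsPadic p N) {A B : Set N} (h : A ⊆ B) : pcl p A ≤ pcl p B :=
  pcl_le (isClosed_pcl B) (pcl_pure hN B) (h.trans (subset_pcl B))

lemma denseRange_hull (A : Set N) :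
    DenseRange (AddSubgroup.inclusion (hull_le_pcl (p := p) A)) := by
  have := denseRange_inclusion_iff (s := (hull p A : Set N)) (t := (pcl p A : Set N))
    (hull_le_pcl A)
  exact this.2 subset_rfl

/-- Integer combinations of `a` and of `b` with the same coefficients have the same norm. -/
def NormEq (a : ι → N) (b : ι → N') : Prop := ∀ c : ι →₀ ℤ, ‖zcomb a c‖ = ‖zcomb b c‖

/-- Families with the same norms of integer combinations generate isomorphic closed pure
subgroups. -/
lemma NormEq.exists_iso (hN : IsPadic p N) (hN' : IsPadic p N') {a : ι → N} {b : ι → N'}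
    (h : NormEq a b) : ∃ φ : pcl p (range a) →+ N', (∀ x, ‖φ x‖ = ‖x‖) ∧
      (∀ i (hi : a i ∈ pcl p (range a)), φ ⟨a i, hi⟩ = b i) ∧ φ.range = pcl p (range b) := by
  have := hN'.complete
  -- `Γ` is the graph of the isometry between the two hulls, matching elements whose `p ^
  -- k`-multiples are combinations with the same coefficients.
  let Γ : AddSubgroup (N × N') :=
    { carrier := {x | ∃ (k : ℕ) (c : ι →₀ ℤ), p ^ k • x.1 = zcomb a c ∧ p ^ k • x.2 = zcomb b c}
      zero_mem' := ⟨0, 0, by simp⟩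
      add_mem' := by
        rintro x y ⟨k, c, h1, h2⟩ ⟨m, d, h3, h4⟩
        refine ⟨k + m, p ^ m • c + p ^ k • d, ?_, ?_⟩
        · rw [map_add, map_nsmul, map_nsmul, ← h1, ← h3, smul_smul, smul_smul, ← pow_add,
            ← pow_add, add_comm m k, ← smul_add, Prod.fst_add]
        · rw [map_add, map_nsmul, map_nsmul, ← h2, ← h4, smul_smul, smul_smul, ← pow_add,
            ← pow_add, add_comm m k, ← smul_add, Prod.snd_add]
      neg_mem' := by
        rintro x ⟨k, c, h1, h2⟩
        exact ⟨k, -c, by rw [map_neg, ← h1, Prod.fst_neg, smul_neg],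
          by rw [map_neg, ← h2, Prod.snd_neg, smul_neg]⟩ }
  have hΓ : ∀ x ∈ Γ, ‖x.2‖ = ‖x.1‖ := by
    rintro x ⟨k, c, h1, h2⟩
    have h3 := h c
    rw [← h1, ← h2, hN.norm_pow_smul, hN'.norm_pow_smul] at h3
    exact (mul_left_cancel₀ (pow_pos (inv_prime_pos p) k).ne' h3).symm
  have hmem : ∀ x ∈ Γ, x.1 ∈ pcl p (range a) ∧ x.2 ∈ pcl p (range b) := by
    rintro x ⟨k, c, h1, h2⟩
    exact ⟨hull_le_pcl _ ⟨k, h1 ▸ zcomb_mem_closure a c⟩,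
      hull_le_pcl _ ⟨k, h2 ▸ zcomb_mem_closure b c⟩⟩
  let i : Γ →+ pcl p (range a) :=
    ((AddMonoidHom.fst N N').comp Γ.subtype).codRestrict _ fun x => (hmem x x.2).1
  let f : Γ →+ N' := (AddMonoidHom.snd N N').comp Γ.subtype
  have hif : ∀ g, ‖f g‖ = ‖i g‖ := fun g => hΓ g g.2
  have hi : DenseRange i := by
    refine (denseRange_hull (p := p) (range a)).mono ?_
    rintro _ ⟨⟨x, k, hk⟩, rfl⟩
    obtain ⟨c, hc⟩ := mem_closure_range_iff_zcomb.1 hk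
    -- Every element of the hull of `a` has a partner: divisibility of a combination by `p ^ k` is
    -- read off its norm, hence transfers from `a` to `b`.
    have : ‖zcomb b c‖ ≤ (p : ℝ)⁻¹ ^ k := by
      rw [← h c, hc, hN.norm_le_iff]
      exact ⟨x, rfl⟩
    obtain ⟨y, hy⟩ := hN'.norm_le_iff.1 this
    exact ⟨⟨(x, y), k, c, hc.symm, hy⟩, rfl⟩
  obtain ⟨φ, hφ, hφi⟩ := exists_extension i hi f fun g => (hif g).le
  have hφn : ∀ x, ‖φ x‖ = ‖x‖ := norm_extension_eq hi hif hφ hφi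
  have hφa : ∀ i (hi : a i ∈ pcl p (range a)), φ ⟨a i, hi⟩ = b i := fun j hj =>
    hφi ⟨(a j, b j), 0, Finsupp.single j 1, by simp, by simp⟩
  have hr := (isPadic_pcl hN (range a)).range hN' φ hφn
  refine ⟨φ, hφn, hφa, le_antisymm ?_ (pcl_le hr.1 hr.2 ?_)⟩
  · rintro _ ⟨x, rfl⟩
    refine hi.induction_on (p := fun x => φ x ∈ pcl p (range b)) x
      ((isClosed_pcl (p := p) (range b)).preimage hφ) fun g => ?_
    rw [hφi]
    exact (hmem g g.2).2
  · rintro _ ⟨j, rfl⟩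
    exact ⟨⟨a j, subset_pcl _ ⟨j, rfl⟩⟩, hφa j _⟩

lemma normEq_of_hom {ι : Type*} {a : ι → N} {b : ι → N'} (f : N →+ N') (hf : ∀ x, ‖f x‖ = ‖x‖)
    (h : ∀ i, f (a i) = b i) : NormEq a b := fun c => by
  rw [← map_zcomb' f h c, hf]

lemma NormEq.symm {a : ι → N} {b : ι → N'} (h : NormEq a b) : NormEq b a := fun c => (h c).symm

lemma NormEq.trans {N'' : Type*} [NormedAddCommGroup N''] {a : ι → N} {b : ι → N'} {c : ι → N''}
    (h : NormEq a b) (h' : NormEq b c) : NormEq a c := fun d => (h d).trans (h' d)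

/-- Each combination involves only the finite support of its coefficients. -/
lemma normEq_of_finite {a : ι → N} {b : ι → N'}
    (h : ∀ (n : ℕ) (s : Fin n → ι), NormEq (a ∘ s) (b ∘ s)) : NormEq a b := fun c => by
  let s : Fin c.support.card → ι := fun i => c.support.equivFin.symm i
  have hs : Function.Injective s :=
    Subtype.val_injective.comp c.support.equivFin.symm.injective
  have hc : c = (c.comapDomain s hs.injOn).mapDomain s := by
    refine (Finsupp.mapDomain_comapDomain s hs c ?_).symm
    intro i hi
    exact ⟨c.support.equivFin ⟨i, hi⟩, by simp [s]⟩
  rw [hc, zcomb_mapDomain, zcomb_mapDomain]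
  exact h _ s _

end Pcl

open FirstOrder.Language (Structure)

/-! ### Groups as structures -/

section GroupStr

/-- The interpretation of `0, +, -` in an abelian group. -/
@[reducible]
def groupStr (G : Type u) [AddCommGroup G] : groupLang.Structure G where
  funMap {n} (f : GroupOp n) v :=
    match n, f, v with
    | _, GroupOp.zero, _ => 0
    | _, GroupOp.add, v => v 0 + v 1
    | _, GroupOp.neg, v => -v 0
  RelMap {_} r _ := Empty.elim r

lemma IsGroupStr.eq_groupStr {G : Type u} [AddCommGroup G] (s : groupLang.Structure G)
    (h : IsGroupStr G) : s = groupStr G := by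
  apply Structure.ext
  · funext n f v
    change GroupOp n at f
    cases f with
    | zero => exact h.1 v
    | add => exact h.2.1 v
    | neg => exact h.2.2 v
  · funext n r
    exact Empty.elim r

/-- `MemKp` and `IsPure` each quantify over a group structure; since the vocabulary contains
addition, all of these coincide. -/
lemma IsGroupStr.unique {G : Type u} [groupLang.Structure G] {i j : AddCommGroup G}
    (hi : @IsGroupStr G i _) (hj : @IsGroupStr G j _) : i = j := by
  refine AddCommGroup.ext ?_
  funext x y
  have h1 := hi.2.1 ![x, y]
  have h2 := hj.2.1 ![x, y]
  exact h1.symm.trans h2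

@[reducible]
instance instGroupStr (N : Type u) [NormedAddCommGroup N] : groupLang.Structure N := groupStr N

/-- A normed group as a metric structure. -/
abbrev ofNormed (N : Type u) [NormedAddCommGroup N] : MetricStr.{u} groupLang :=
  { carrier := N
    str := groupStr N }

lemma isGroupStr_ofNormed (N : Type u) [i : NormedAddCommGroup N] :
    @IsGroupStr (ofNormed N) (NormedAddCommGroup.toAddCommGroup (E := N)) _ :=
  ⟨fun _ => rfl, fun _ => rfl, fun _ => rfl⟩

/-! ### Homomorphisms and subgroups as embeddings and substructures. -/

section Maps

variable {N N' : Type u} [NormedAddCommGroup N] [NormedAddCommGroup N']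

/-- Embeddings of groups as structures are homomorphisms. -/
def toHom (f : ofNormed N ↪[groupLang] ofNormed N') : N →+ N' :=
  AddMonoidHom.mk' (fun x : N => (f x : N')) fun x y => by
    have := f.map_fun (n := 2) (GroupOp.add : GroupOp 2) ![x, y]
    exact this

/-- An injective homomorphism as an embedding of structures. -/
def ofHom (f : N →+ N') (hf : Function.Injective f) : ofNormed N ↪[groupLang] ofNormed N' where
  toFun := f
  inj' := hf
  map_fun' {n} (φ : GroupOp n) v := by
    cases φ with
    | zero => exact f.map_zero
    | add => exact f.map_add _ _
    | neg => exact f.map_neg _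
  map_rel' {n} r := Empty.elim r

/-- A group isomorphism as an isomorphism of structures. -/
def ofAddEquiv (f : N ≃+ N') : ofNormed N ≃[groupLang] ofNormed N' where
  toEquiv := f.toEquiv
  map_fun' {n} (φ : GroupOp n) v := by
    cases φ with
    | zero => exact f.map_zero
    | add => exact f.map_add _ _
    | neg => exact f.map_neg _
  map_rel' {n} r := Empty.elim r

lemma isometry_iff_norm (f : ofNormed N ↪[groupLang] ofNormed N') :
    Isometry f ↔ ∀ x, ‖toHom f x‖ = ‖x‖ :=
  ⟨fun h => (AddMonoidHomClass.isometry_iff_norm (toHom f)).1 h,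
    fun h => (AddMonoidHomClass.isometry_iff_norm (toHom f)).2 h⟩

lemma isometry_ofHom (f : N →+ N') (hf : ∀ x, ‖f x‖ = ‖x‖) :
    Isometry (ofHom f (AddMonoidHomClass.isometry_of_norm f hf).injective) :=
  AddMonoidHomClass.isometry_of_norm f hf

lemma isometry_ofAddEquiv (f : N ≃+ N') (hf : ∀ x, ‖f x‖ = ‖x‖) : Isometry (ofAddEquiv f) :=
  AddMonoidHomClass.isometry_of_norm f hf

/-- The subgroup underlying a substructure. -/
def toAddSubgroup (X : groupLang.Substructure (ofNormed N)) : AddSubgroup N where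
  carrier := X
  zero_mem' := X.fun_mem (n := 0) (GroupOp.zero : GroupOp 0) ![] (fun i => i.elim0)
  add_mem' {x y} hx hy := X.fun_mem (n := 2) (GroupOp.add : GroupOp 2) ![x, y] (by
    intro i
    fin_cases i
    exacts [hx, hy])
  neg_mem' {x} hx := X.fun_mem (n := 1) (GroupOp.neg : GroupOp 1) ![x] (by
    intro i
    fin_cases i
    exact hx)

/-- A subgroup as a substructure. -/
def ofAddSubgroup (S : AddSubgroup N) : groupLang.Substructure (ofNormed N) where
  carrier := S
  fun_mem {n} (φ : GroupOp n) v hv := by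
    cases φ with
    | zero => exact S.zero_mem
    | add => exact S.add_mem (hv 0) (hv 1)
    | neg => exact S.neg_mem (hv 0)

@[simp]
lemma coe_ofAddSubgroup (S : AddSubgroup N) : (ofAddSubgroup S : Set N) = S := rfl

lemma ofAddSubgroup_toAddSubgroup (X : groupLang.Substructure (ofNormed N)) :
    ofAddSubgroup (toAddSubgroup X) = X := rfl

lemma ind_ofAddSubgroup (S : AddSubgroup N) :
    (ofNormed N).ind (ofAddSubgroup S) = ofNormed S := by
  have h : Language.Substructure.inducedStructure (S := ofAddSubgroup S) = groupStr S := by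
    apply Structure.ext
    · funext n f v
      change GroupOp n at f
      cases f <;> rfl
    · funext n r
      exact Empty.elim r
  exact congrArg (@MetricStr.mk _ S _) h

end Maps

end GroupStr

/-! ### The class in terms of normed groups -/

section Mem

variable {p : ℕ} [hp : Fact p.Prime]

/-- The distance is translation invariant on the dense image of `j`, hence everywhere by continuity,
so it comes from a norm. -/
lemma exists_ofNormed (M : MetricStr.{u} groupLang) (h : MemKp p M) :
    ∃ (N : Type u) (_ : NormedAddCommGroup N), IsPadic p N ∧ M = ofNormed N := by
  obtain ⟨g, hg, ht, hc, κ, j, hj, hd⟩ := h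
  obtain @⟨N, m, s⟩ := M
  change IsGroupStr N at hg
  have hinv : ∀ x y z : N, dist (x + z) (y + z) = dist x y := by
    have h1 : ∀ a b c, dist (j a + j c) (j b + j c) = dist (j a) (j b) := fun a b c => by
      rw [← map_add, ← map_add, hd, hd, add_sub_add_right_eq_sub]
    intro x y z
    refine hj.induction_on₃ (p := fun x y z : N => dist (x + z) (y + z) = dist x y)
      (isClosed_eq (by fun_prop) (by fun_prop)) h1 x y z
  let inst : NormedAddCommGroup N :=
    { g, m with
      norm := fun x => dist x 0
      dist_eq := fun x y => by
        have := hinv x y (-x)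
        rw [add_neg_cancel] at this
        rw [← this, dist_comm, add_comm y] }
  refine ⟨N, inst, ?_, ?_⟩
  · refine IsPadic.of_dense (p := p) (fun x hx => ?_) j hj fun x => ?_
    · refine finsupp_eq_zero_of_prime_smul (fun y hy => ?_) x hx
      have hp0 : (p : ℤ_[p]) ≠ 0 := by exact_mod_cast hp.out.ne_zero
      simpa [hp0] using hy
    · have := hd x 0
      rw [sub_zero, map_zero] at this
      exact this
  · have : s = groupStr N := hg.eq_groupStr
    exact congrArg (@MetricStr.mk _ N m) this

/-- An integer divisible by `p` in `ℤ_[p]` is divisible by `p` in `ℤ`. -/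
lemma pIndep_single_padicInt (κ : Type u) :
    PIndep p (fun i : κ => Finsupp.single i (1 : ℤ_[p])) := by
  rintro c ⟨y, hy⟩
  have h1 : zcomb (fun i : κ => Finsupp.single i (1 : ℤ_[p])) =
      Finsupp.mapRange.addMonoidHom (Int.castAddHom ℤ_[p]) := by
    ext i
    simp
  rw [h1] at hy
  refine ⟨c.mapRange (fun x => x / p) (by simp), ?_⟩
  ext i
  have h2 : (p : ℤ_[p]) * y i = (c i : ℤ_[p]) := by simpa using DFunLike.congr_fun hy i
  have h3 : (p : ℤ) ∣ c i := by
    rw [← PadicInt.norm_int_lt_one_iff_dvd, PadicInt.norm_lt_one_iff_dvd]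
    exact ⟨y i, h2.symm⟩
  simpa using Int.mul_ediv_cancel' h3

lemma pSpan_single_padicInt (κ : Type u) :
    PSpan p (fun i : κ => Finsupp.single i (1 : ℤ_[p])) := by
  intro x
  induction x using Finsupp.induction_linear with
  | zero => exact ⟨0, 0, by simp⟩
  | add x y hx hy =>
    obtain ⟨c, x', hx⟩ := hx
    obtain ⟨d, y', hy⟩ := hy
    refine ⟨c + d, x' + y', ?_⟩
    rw [map_add, smul_add, hx, hy]
    abel
  | single i a =>
    obtain ⟨n, -, hn⟩ := PadicInt.exists_mem_range a
    rw [PadicInt.maximalIdeal_eq_span_p, Ideal.mem_span_singleton] at hn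
    obtain ⟨b, hb⟩ := hn
    refine ⟨Finsupp.single i n, Finsupp.single i b, ?_⟩
    rw [zcomb_single, Finsupp.smul_single, Finsupp.smul_single, ← Finsupp.single_add,
      nsmul_eq_mul, ← hb]
    simp

/-- For a basis indexed by `κ`, the group `κ →₀ ℤ` with its `p`-adic norm maps isometrically and
densely both to `N` and to `κ →₀ ℤ_[p]`; the required `j` extends the first map along the second. -/
lemma memKp_ofNormed {N : Type u} [NormedAddCommGroup N] (hN : IsPadic p N) :
    MemKp p (ofNormed N) := by
  have := hN.complete
  obtain ⟨κ, e, he⟩ := hN.exists_basis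
  let i : (κ →₀ ℤ) →+ WithPadic p (κ →₀ ℤ_[p]) :=
    zcomb (G := κ →₀ ℤ_[p]) fun i : κ => Finsupp.single i (1 : ℤ_[p])
  have hi : DenseRange i :=
    PSpan.denseRange (p := p) (W := WithPadic p (κ →₀ ℤ_[p])) (fun x => rfl)
      (pSpan_single_padicInt κ)
  have hni : ∀ c, ‖zcomb e c‖ = ‖i c‖ := fun c => by
    rw [he.1.norm_zcomb hN]
    refine ((pIndep_single_padicInt κ).padicNormOf_zcomb (fun x hx => ?_) c).symm
    refine finsupp_eq_zero_of_prime_smul (fun y hy => ?_) x hx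
    have hp0 : (p : ℤ_[p]) ≠ 0 := by exact_mod_cast hp.out.ne_zero
    simpa [hp0] using hy
  obtain ⟨j, hj, hji⟩ := exists_extension i hi (zcomb e) fun c => (hni c).le
  have hjn := norm_extension_eq hi hni hj hji
  refine ⟨NormedAddCommGroup.toAddCommGroup (E := N), isGroupStr_ofNormed N,
    inferInstanceAs (IsTopologicalAddGroup N), hN.complete, κ, j, ?_, fun x y => ?_⟩
  · refine he.2.mono ?_
    rintro _ ⟨c, rfl⟩
    exact ⟨i c, hji c⟩
  · refine (dist_eq_norm (E := N) (j x) (j y)).trans ?_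
    exact (congrArg norm (map_sub j x y)).symm.trans (hjn (x - y))

lemma strong_ofNormed_iff {N : Type u} [NormedAddCommGroup N] (hN : IsPadic p N)
    (X : groupLang.Substructure (ofNormed N)) :
    (Kp p).Strong (ofNormed N) X ↔ IsClosed (X : Set N) ∧ ∀ x : N, p • x ∈ X → x ∈ X := by
  constructor
  · rintro ⟨-, -, h1, g, hg, h2⟩
    refine ⟨h1, fun x hx => ?_⟩
    have hgi : g = (NormedAddCommGroup.toAddCommGroup (E := N) : AddCommGroup N) := hg.unique (isGroupStr_ofNormed N)
    subst hgi
    obtain ⟨y, hy, hyx⟩ := h2 p (p • x) hx ⟨x, natCast_zsmul (x : N) p⟩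
    have : p • (y : N) = p • x := (natCast_zsmul (y : N) p).symm.trans hyx
    rwa [← smul_injective_of hN.eq_zero this]
  · rintro ⟨h1, h2⟩
    refine ⟨memKp_ofNormed hN, ?_, h1, NormedAddCommGroup.toAddCommGroup (E := N), isGroupStr_ofNormed N, ?_⟩
    · rw [← ofAddSubgroup_toAddSubgroup X, ind_ofAddSubgroup]
      exact memKp_ofNormed (hN.addSubgroup (S := toAddSubgroup X) h1 h2)
    · rintro n b hb ⟨a, ha⟩
      rcases eq_or_ne n 0 with rfl | hn
      · refine ⟨b, hb, ?_⟩
        have hb0 : b = (0 : N) := ha.symm.trans (zero_smul ℤ (a : N))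
        rw [hb0]
        exact smul_zero (A := N) (0 : ℤ)
      · have ha' : n • (a : N) = b := ha
        exact ⟨a, hN.mem_of_zsmul_mem (S := toAddSubgroup X) h1 h2 hn (ha' ▸ hb), ha⟩

lemma strong_iff {B : MetricStr.{u} groupLang} (hB : MemKp p B) [i : AddCommGroup B]
    (hi : IsGroupStr B) (X : groupLang.Substructure B) :
    (Kp p).Strong B X ↔ IsClosed (X : Set B) ∧ ∀ x : B, p • x ∈ X → x ∈ X := by
  obtain ⟨N, inst, hN, rfl⟩ := exists_ofNormed B hB
  have hgi : i = (NormedAddCommGroup.toAddCommGroup (E := N) : AddCommGroup N) := hi.unique (isGroupStr_ofNormed N)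
  subst hgi
  exact strong_ofNormed_iff hN X

/-- Closedness and purity of the image are automatic by `IsPadic.range`. -/
lemma isKEmb_iff {A B : MetricStr.{u} groupLang} (hA : MemKp p A) (hB : MemKp p B)
    (f : A ↪[groupLang] B) : IsKEmb (Kp p) f ↔ Isometry f := by
  refine ⟨fun h => h.1, fun h => ⟨h, ?_⟩⟩
  obtain ⟨N, inst, hN, rfl⟩ := exists_ofNormed A hA
  obtain ⟨N', inst', hN', rfl⟩ := exists_ofNormed B hB
  rw [strong_ofNormed_iff hN']
  exact hN.range hN' (toHom f) ((isometry_iff_norm f).1 h)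

/-- Embeddings preserve norms of combinations. Conversely, equal norms give an isometric map of the
closed pure hull of `a` into `N'`, and `N` and `N'` are amalgamated over that hull. -/
lemma sameGaloisType_iff {N N' : Type u} [NormedAddCommGroup N] [NormedAddCommGroup N']
    (hN : IsPadic p N) (hN' : IsPadic p N') {ι : Type*} {a : ι → N} {b : ι → N'} :
    SameGaloisType (Kp p) (A := ofNormed N) (B := ofNormed N') a b ↔ NormEq a b := by
  constructor
  · rintro ⟨C, f, g, hC, hf, hg, hfg⟩
    obtain ⟨D, inst, hD, rfl⟩ := exists_ofNormed C hC
    have h1 : NormEq a (fun i => toHom f (a i)) :=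
      normEq_of_hom _ ((isometry_iff_norm f).1 hf.1) fun _ => rfl
    have h2 : NormEq b (fun i => toHom g (b i)) :=
      normEq_of_hom _ ((isometry_iff_norm g).1 hg.1) fun _ => rfl
    have h3 : (fun i => toHom f (a i)) = fun i => toHom g (b i) := funext hfg
    rw [h3] at h1
    exact h1.trans h2.symm
  · intro h
    obtain ⟨φ, hφ, hφa, -⟩ := h.exists_iso hN hN'
    obtain ⟨f, g, hf, hg, hfg⟩ := (isPadic_pcl hN (range a)).exists_amalgam hN
      (pcl p (range a)).subtype (fun _ => rfl) φ hφ
    have hD := memKp_ofNormed (hN'.prod hN)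
    refine ⟨ofNormed (N' × N), _, _, hD, (isKEmb_iff (memKp_ofNormed hN) hD _).2
      (isometry_ofHom f hf), (isKEmb_iff (memKp_ofNormed hN') hD _).2 (isometry_ofHom g hg),
      fun i => ?_⟩
    have := hfg ⟨a i, subset_pcl _ ⟨i, rfl⟩⟩
    rw [hφa] at this
    exact this

end Mem

/-! ### Density characters -/

section DensityChar

lemma densityChar_le {X : Type u} [TopologicalSpace X] {D : Set X} (hD : Dense D) :
    densityChar X ≤ #D := csInf_le' ⟨D, hD, rfl⟩

lemma exists_dense_card_eq (X : Type u) [TopologicalSpace X] :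
    ∃ D : Set X, Dense D ∧ #D = densityChar X :=
  csInf_mem (s := {μ | ∃ D : Set X, Dense D ∧ #D = μ}) ⟨_, univ, dense_univ, rfl⟩

lemma densityChar_le_of_denseRange {X ι : Type u} [TopologicalSpace X] {f : ι → X}
    (hf : DenseRange f) : densityChar X ≤ #ι := (densityChar_le hf).trans mk_range_le

lemma mk_le_densityChar {X κ : Type u} [PseudoMetricSpace X] (v : κ → X)
    (hv : ∀ i j, i ≠ j → 1 ≤ dist (v i) (v j)) : #κ ≤ densityChar X := by
  obtain ⟨D, hD, hc⟩ := exists_dense_card_eq X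
  rw [← hc]
  have : ∀ i, ∃ d : D, dist (v i) d < 1 / 2 := fun i => by
    obtain ⟨d, hd, h⟩ := hD.exists_dist_lt (v i) (by norm_num : (0 : ℝ) < 1 / 2)
    exact ⟨⟨d, hd⟩, h⟩
  choose d hd using this
  refine mk_le_of_injective (f := d) fun i j hij => ?_
  by_contra hne
  have h1 := hv i j hne
  have h2 := dist_triangle_right (v i) (v j) (d i)
  have h3 := hd i
  have h4 := hd j
  rw [← hij] at h4
  linarith

lemma aleph0_le_densityChar (X : Type u) [TopologicalSpace X] [T1Space X] [Infinite X] :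
    ℵ₀ ≤ densityChar X := by
  obtain ⟨D, hD, hc⟩ := exists_dense_card_eq X
  rw [← hc]
  by_contra! h
  have hf : D.Finite := Cardinal.lt_aleph0_iff_set_finite.1 h
  have := hD.closure_eq
  rw [hf.isClosed.closure_eq] at this
  exact infinite_univ (this ▸ hf)

lemma densityChar_prod_le (X Y : Type u) [TopologicalSpace X] [TopologicalSpace Y] :
    densityChar (X × Y) ≤ densityChar X * densityChar Y := by
  obtain ⟨D, hD, hc⟩ := exists_dense_card_eq X
  obtain ⟨E, hE, hc'⟩ := exists_dense_card_eq Y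
  refine (densityChar_le (hD.prod hE)).trans ?_
  rw [Cardinal.mk_setProd, hc, hc']

lemma mk_finsupp_int_le (κ : Type u) : #(κ →₀ ℤ) ≤ max #κ ℵ₀ := by
  rcases isEmpty_or_nonempty κ with h | h
  · exact (mk_le_aleph0 (α := κ →₀ ℤ)).trans (le_max_right _ _)
  · rw [Cardinal.mk_finsupp_lift_of_infinite', Cardinal.mk_int, Cardinal.lift_aleph0,
      Cardinal.lift_id'.{0, u}]

lemma mk_closure_le {G : Type u} [AddCommGroup G] (A : Set G) :
    #(AddSubgroup.closure A) ≤ #A + ℵ₀ := by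
  have h1 : #(AddSubgroup.closure A) ≤ #(A →₀ ℤ) := by
    refine mk_le_of_surjective
      (f := fun c : A →₀ ℤ => (⟨zcomb Subtype.val c, ?_⟩ : AddSubgroup.closure A)) ?_
    · simpa using zcomb_mem_closure (Subtype.val : A → G) c
    · rintro ⟨x, hx⟩
      have hx' : x ∈ AddSubgroup.closure (range (Subtype.val : A → G)) := by simpa using hx
      obtain ⟨c, hc⟩ := mem_closure_range_iff_zcomb.1 hx'
      exact ⟨c, Subtype.ext hc⟩
  exact (h1.trans (mk_finsupp_int_le A)).trans (max_le le_self_add le_add_self)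

lemma mk_hull_le {p : ℕ} [Fact p.Prime] {N : Type u} [NormedAddCommGroup N] (hN : IsPadic p N)
    (A : Set N) : #(hull p A) ≤ #A + ℵ₀ := by
  choose k hk using fun x : hull p A => x.2
  have h1 : #(hull p A) ≤ #(ULift.{u} ℕ × AddSubgroup.closure A) := by
    -- Without `p`-torsion, an element is determined by an exponent `k` and its multiple by `p ^ k`.
    refine mk_le_of_injective (f := fun x => (⟨k x⟩, ⟨_, hk x⟩)) fun x y hxy => ?_
    have h2 : k x = k y := congrArg (fun z => z.1.down) hxy
    have h3 : p ^ k x • (x : N) = p ^ k y • (y : N) := congrArg (fun z => (z.2 : N)) hxy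
    rw [h2] at h3
    exact Subtype.ext (hN.pow_smul_injective _ h3)
  refine h1.trans ?_
  rw [mk_prod, Cardinal.lift_id, Cardinal.lift_id, mk_uLift, Cardinal.mk_nat, Cardinal.lift_aleph0]
  have h4 : (ℵ₀ : Cardinal.{u}) ≤ #A + ℵ₀ := le_add_self
  exact (mul_le_mul' h4 (mk_closure_le A)).trans (Cardinal.mul_eq_self h4).le

lemma densityChar_pcl_le {p : ℕ} [Fact p.Prime] {N : Type u} [NormedAddCommGroup N]
    (hN : IsPadic p N) (A : Set N) : densityChar (pcl p A) ≤ #A + ℵ₀ :=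
  (densityChar_le_of_denseRange (denseRange_hull (p := p) A)).trans (mk_hull_le hN A)

lemma densityChar_pcl_lt {p : ℕ} [Fact p.Prime] {N : Type u} [NormedAddCommGroup N]
    (hN : IsPadic p N) {A : Set N} {lam : Cardinal.{u}} (hA : #A < lam) (hl : ℵ₀ < lam) :
    densityChar (pcl p A) < lam :=
  (densityChar_pcl_le hN A).trans_lt (Cardinal.add_lt_of_lt hl.le hA hl)

lemma PIndep.one_le_dist {p : ℕ} [hp : Fact p.Prime] {N κ : Type*} [NormedAddCommGroup N]
    (hN : IsPadic p N) {e : κ → N} (he : PIndep p e) {i j : κ} (hij : i ≠ j) :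
    1 ≤ dist (e i) (e j) := by
  by_contra! h
  rw [dist_eq_norm] at h
  obtain ⟨y, hy⟩ := hN.exists_of_norm_lt_one h
  obtain ⟨c, hc⟩ := he (Finsupp.single i 1 - Finsupp.single j 1) ⟨y, by simpa using hy⟩
  have h1 := DFunLike.congr_fun hc i
  have h2 : (p : ℤ) * c i = 1 := by simpa [hij.symm] using h1
  have h3 := Int.eq_one_or_neg_one_of_mul_eq_one h2
  have := hp.out.one_lt
  omega

lemma PIndep.mk_le {p : ℕ} [hp : Fact p.Prime] {N κ : Type u} [NormedAddCommGroup N]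
    (hN : IsPadic p N) {e : κ → N} (he : PIndep p e) : #κ ≤ densityChar N :=
  mk_le_densityChar e fun _ _ h => he.one_le_dist hN h

end DensityChar

/-! ### The class is a metric abstract elementary class -/

section MAEC

variable {p : ℕ} [hp : Fact p.Prime]

lemma memKp_of_isometry {A B : MetricStr.{u} groupLang} (e : A ≃[groupLang] B) (he : Isometry e)
    (hA : MemKp p A) : MemKp p B := by
  obtain ⟨N, inst, hN, rfl⟩ := exists_ofNormed A hA
  obtain ⟨g, hg, ht, hc, κ, j, hj, hd⟩ := hA
  have hgi : g = NormedAddCommGroup.toAddCommGroup (E := N) := hg.unique (isGroupStr_ofNormed N)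
  subst hgi
  let iB : AddCommGroup B := e.toEquiv.symm.addCommGroup
  let a : B ≃+ N := e.toEquiv.symm.addEquiv
  have hae : ∀ x, e (a x) = x := fun x => e.toEquiv.apply_symm_apply x
  have hea : ∀ x, a.symm x = e x := fun x => rfl
  have hadd : ∀ x y : B, x + y = e (a x + a y) := fun x y => rfl
  have hai : Isometry a := fun x y => by rw [← he.edist_eq, hae, hae]
  refine ⟨iB, ⟨fun v => ?_, fun v => ?_, fun v => ?_⟩, ?_, ?_, κ, a.symm.toAddMonoidHom.comp j,
    ?_, fun x y => ?_⟩
  · have := e.map_fun (n := 0) (GroupOp.zero : GroupOp 0) (a ∘ v)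
    have h2 : e ∘ a ∘ v = v := funext fun i => hae _
    rw [h2] at this
    exact this.symm
  · have := e.map_fun (n := 2) (GroupOp.add : GroupOp 2) (a ∘ v)
    have h2 : e ∘ a ∘ v = v := funext fun i => hae _
    rw [h2] at this
    exact this.symm
  · have := e.map_fun (n := 1) (GroupOp.neg : GroupOp 1) (a ∘ v)
    have h2 : e ∘ a ∘ v = v := funext fun i => hae _
    rw [h2] at this
    exact this.symm
  · exact hai.isUniformInducing.isInducing.topologicalAddGroup a
  · exact (hai.isUniformInducing.completeSpace_congr a.surjective).2 hN.complete
  · exact e.surjective.denseRange.comp hj he.continuous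
  · exact (he.dist_eq _ _).trans (hd x y)

lemma strong_ind_iff {N : Type u} [NormedAddCommGroup N]
    {T : groupLang.Substructure (ofNormed N)} (hT : (Kp p).Strong (ofNormed N) T)
    (X : groupLang.Substructure (ofNormed N)) :
    (Kp p).Strong ((ofNormed N).ind T) (X.comap T.subtype.toHom) ↔
      IsClosed ((↑) ⁻¹' (X : Set N) : Set T) ∧ ∀ x : N, x ∈ T → p • x ∈ X → x ∈ X := by
  let i : AddCommGroup ((ofNormed N).ind T) := inferInstanceAs (AddCommGroup (toAddSubgroup T))
  have hi : IsGroupStr ((ofNormed N).ind T) := ⟨fun _ => rfl, fun _ => rfl, fun _ => rfl⟩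
  rw [strong_iff hT.2.1 hi]
  refine and_congr Iff.rfl ⟨fun h x hx hpx => ?_, fun h x hx => ?_⟩
  · exact h ⟨x, hx⟩ hpx
  · exact h x.1 x.2 hx

/-- The algebraic direct limit is `p`-torsion-free, and its own `p`-adic norm restricts to the given
norm on each member, so its completion is the required model. -/
lemma exists_completion_chain {ι : Type u} [LinearOrder ι] [Nonempty ι] (N : ι → Type u)
    [∀ i, NormedAddCommGroup (N i)] (hN : ∀ i, IsPadic p (N i))
    (f : ∀ i j, i ≤ j → N i →+ N j) (hf : ∀ i j h x, ‖f i j h x‖ = ‖x‖)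
    (hid : ∀ i x, f i i le_rfl x = x)
    (hc : ∀ i j k hij hjk x, f j k hjk (f i j hij x) = f i k (hij.trans hjk) x) :
    ∃ (U : Type u) (_ : NormedAddCommGroup U) (g : ∀ i, N i →+ U), IsPadic p U ∧
      (∀ i x, ‖g i x‖ = ‖x‖) ∧ (∀ i j h x, g j (f i j h x) = g i x) ∧
      Dense (⋃ i, range (g i)) := by
  classical
  have hds : DirectedSystem N fun i j h => f i j h :=
    ⟨fun i x => hid i x, fun k j i hij hjk x => hc i j k hij hjk x⟩
  let G := AddCommGroup.DirectLimit N f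
  have hex : ∀ z : G, ∃ i x, AddCommGroup.DirectLimit.of N f i x = z := fun z =>
    AddCommGroup.DirectLimit.induction_on z fun i x => ⟨i, x, rfl⟩
  have hinj : ∀ i, Function.Injective (AddCommGroup.DirectLimit.of N f i) := fun i => by
    rw [injective_iff_map_eq_zero]
    intro x hx
    obtain ⟨j, hij, h⟩ := AddCommGroup.DirectLimit.of.zero_exact i x hx
    rw [← norm_eq_zero, ← hf i j hij, h, norm_zero]
  have ht : ∀ z : G, p • z = 0 → z = 0 := fun z hz => by
    obtain ⟨i, x, rfl⟩ := hex z
    rw [← map_nsmul, map_eq_zero_iff _ (hinj i)] at hz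
    rw [(hN i).eq_zero x hz, map_zero]
  have hnorm : ∀ i x, padicNormOf p (AddCommGroup.DirectLimit.of N f i x) = ‖x‖ := fun i x => by
    rw [(hN i).norm_eq]
    refine padicNormOf_congr fun k => ⟨?_, ?_⟩
    · rintro ⟨z, hz⟩
      obtain ⟨j, y, rfl⟩ := hex z
      -- A divisor may appear only at a later stage, but divisibility is a norm inequality and the
      -- transition maps are isometric, so it already holds at stage `i`.
      have h1 : p ^ k • f j (max i j) (le_max_right _ _) y = f i (max i j) (le_max_left _ _) x := by
        apply hinj (max i j)
        rw [map_nsmul, AddCommGroup.DirectLimit.of_f, AddCommGroup.DirectLimit.of_f, hz]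
      have h2 := (hN (max i j)).norm_le_iff.2 ⟨_, h1⟩
      rw [hf] at h2
      exact (hN i).norm_le_iff.1 h2
    · rintro ⟨y, rfl⟩
      exact ⟨_, (map_nsmul _ _ _).symm⟩
  let c : WithPadic p G →+ UniformSpace.Completion (WithPadic p G) :=
    UniformSpace.Completion.toCompl
  refine ⟨UniformSpace.Completion (WithPadic p G), inferInstance,
    fun i => c.comp (AddCommGroup.DirectLimit.of N f i), IsPadic.completion ht, fun i x => ?_,
    fun i j h x => ?_, ?_⟩
  · exact (UniformSpace.Completion.norm_coe (E := WithPadic p G) _).trans (hnorm i x)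
  · exact congrArg c (AddCommGroup.DirectLimit.of_f h x)
  · refine (UniformSpace.Completion.denseRange_coe (α := WithPadic p G)).mono ?_
    rintro _ ⟨z, rfl⟩
    obtain ⟨i, x, rfl⟩ := hex z
    exact mem_iUnion.2 ⟨i, x, rfl⟩

lemma exists_closure_chain {ι : Type u} [LinearOrder ι] [Nonempty ι] (N : ι → Type u)
    [∀ i, NormedAddCommGroup (N i)] (hN : ∀ i, IsPadic p (N i)) {B : Type u}
    [NormedAddCommGroup B] (hB : IsPadic p B) (g : ∀ i, N i →+ B) (hg : ∀ i x, ‖g i x‖ = ‖x‖)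
    (hm : ∀ i j, i ≤ j → range (g i) ⊆ range (g j)) :
    ∃ S : AddSubgroup B, (S : Set B) = closure (⋃ i, range (g i)) ∧
      ∀ x : B, p • x ∈ S → x ∈ S := by
  have hcoe : ((⨆ i, (g i).range : AddSubgroup B) : Set B) = ⋃ i, range (g i) := by
    rw [AddSubgroup.coe_iSup_of_directed]
    · rfl
    · intro i j
      exact ⟨max i j, hm i _ (le_max_left _ _), hm j _ (le_max_right _ _)⟩
  refine ⟨(⨆ i, (g i).range).topologicalClosure, ?_, hB.topologicalClosure fun x hx => ?_⟩
  · rw [AddSubgroup.topologicalClosure_coe, hcoe]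
  · rw [← SetLike.mem_coe, hcoe, mem_iUnion] at hx ⊢
    obtain ⟨i, hi⟩ := hx
    exact ⟨i, ((hN i).range hB (g i) (hg i)).2 x hi⟩

lemma exists_strong_of_subset {A : MetricStr.{u} groupLang} (hA : MemKp p A) (C : Set A) :
    ∃ S : groupLang.Substructure A, C ⊆ S ∧ (Kp p).Strong A S ∧ densityChar S ≤ #C + ℵ₀ := by
  obtain ⟨N, inst, hN, rfl⟩ := exists_ofNormed A hA
  exact ⟨ofAddSubgroup (pcl p C), subset_pcl C,
    (strong_ofNormed_iff hN _).2 ⟨isClosed_pcl C, pcl_pure hN C⟩, densityChar_pcl_le hN C⟩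

lemma uniformContinuous_funMap {N : Type u} [NormedAddCommGroup N] (n : ℕ)
    (f : groupLang.Functions n) : UniformContinuous (fun v : Fin n → N => Language.Structure.funMap f v) := by
  change GroupOp n at f
  cases f with
  | zero => exact uniformContinuous_const
  | add =>
    exact (Pi.uniformContinuous_proj (fun _ : Fin 2 => N) 0).add
      (Pi.uniformContinuous_proj (fun _ : Fin 2 => N) 1)
  | neg => exact (Pi.uniformContinuous_proj (fun _ : Fin 1 => N) 0).neg

lemma isMAEC_Kp (p : ℕ) [Fact p.Prime] : IsMAEC (Kp.{u} p) where
  complete := by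
    rintro A ⟨_, _, _, h, _⟩
    exact h
  uniformContinuous A hA n f := by
    obtain ⟨N, inst, hN, rfl⟩ := exists_ofNormed A hA
    exact uniformContinuous_funMap n f
  mem_iso A B e he hA := memKp_of_isometry e he hA
  strong_iso A B e he S hS := by
    have hA := hS.1
    have hB := memKp_of_isometry e he hA
    obtain ⟨N, inst, hN, rfl⟩ := exists_ofNormed A hA
    obtain ⟨N', inst', hN', rfl⟩ := exists_ofNormed B hB
    rw [strong_ofNormed_iff hN] at hS
    rw [strong_ofNormed_iff hN']
    refine ⟨?_, ?_⟩
    · have := hN.complete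
      have h1 : IsClosed (e '' S) :=
        (Isometry.isClosedEmbedding (α := N) he).isClosedMap _ hS.1
      exact h1
    · rintro x ⟨y, hy, hyx⟩
      obtain ⟨z, rfl⟩ := e.surjective x
      have h1 : e (p • (z : N) : N) = e y :=
        (map_nsmul (toHom e.toEmbedding) p z).trans hyx.symm
      refine ⟨z, hS.2 z ?_, rfl⟩
      rw [e.injective h1]
      exact hy
  strong_mem B S hS := ⟨hS.1, hS.2.1⟩
  strong_refl B hB := by
    obtain ⟨N, inst, hN, rfl⟩ := exists_ofNormed B hB
    exact (strong_ofNormed_iff hN _).2 ⟨isClosed_univ, fun _ _ => trivial⟩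
  strong_trans C S T hST hS hT := by
    obtain ⟨N, inst, hN, rfl⟩ := exists_ofNormed C hT.1
    rw [strong_ind_iff hT] at hS
    rw [strong_ofNormed_iff hN] at hT ⊢
    refine ⟨?_, fun x hx => hS.2 x (hT.2 x (hST hx)) hx⟩
    have h1 := hT.1.isClosedEmbedding_subtypeVal.isClosedMap _ hS.1
    have h2 : (Subtype.val '' ((↑) ⁻¹' (S : Set N) : Set T)) = (S : Set N) := by
      ext x
      exact ⟨fun ⟨y, hy, h⟩ => h ▸ hy, fun hx => ⟨⟨x, hST hx⟩, hx, rfl⟩⟩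
    rw [← h2]
    exact h1
  chain ι _ _ _ A f hA hf hid hc := by
    choose N inst hN hAN using fun i => exists_ofNormed (A i) (hA i)
    obtain rfl : A = fun i => ofNormed (N i) := funext hAN
    have hfn : ∀ i j h x, ‖toHom (f i j h) x‖ = ‖x‖ := fun i j h =>
      (isometry_iff_norm _).1 (hf i j h).1
    refine ⟨?_, fun B g hB hg hgf => ?_⟩
    · obtain ⟨U, _, g, hU, hg, hgf, hd⟩ :=
        exists_completion_chain N hN (fun i j h => toHom (f i j h)) hfn hid hc
      exact ⟨ofNormed U, fun i => ofHom (g i) _, memKp_ofNormed hU,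
        fun i => (isKEmb_iff (hA i) (memKp_ofNormed hU) _).2 (isometry_ofHom (g i) (hg i)), hgf, hd⟩
    · obtain ⟨B, _, hB', rfl⟩ := exists_ofNormed B hB
      obtain ⟨S, hS, hSp⟩ := exists_closure_chain N hN hB' (fun i => toHom (g i))
        (fun i => (isometry_iff_norm _).1 (hg i).1) (by
          rintro i j h _ ⟨x, rfl⟩
          exact ⟨f i j h x, hgf i j h x⟩)
      refine ⟨ofAddSubgroup S, hS, (strong_ofNormed_iff hB' _).2 ⟨?_, hSp⟩⟩
      rw [coe_ofAddSubgroup, hS]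
      exact isClosed_closure
  coherence C S T hS hT hST := by
    obtain ⟨N, inst, hN, rfl⟩ := exists_ofNormed C hT.1
    rw [strong_ind_iff hT]
    rw [strong_ofNormed_iff hN] at hS
    exact ⟨hS.1.preimage continuous_subtype_val, fun x _ => hS.2 x⟩
  exists_ls := ⟨ℵ₀, fun _ hA C => exists_strong_of_subset hA C⟩

lemma jep_Kp (p : ℕ) [Fact p.Prime] : JEP (Kp.{u} p) := by
  intro A B hA hB
  obtain ⟨N, _, hN, rfl⟩ := exists_ofNormed A hA
  obtain ⟨N', _, hN', rfl⟩ := exists_ofNormed B hB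
  have hD := memKp_ofNormed (hN.prod hN')
  exact ⟨ofNormed (N × N'), _, _, hD,
    (isKEmb_iff hA hD _).2
      (isometry_ofHom (AddMonoidHom.inl N N') fun x => by simp [Prod.norm_def]),
    (isKEmb_iff hB hD _).2
      (isometry_ofHom (AddMonoidHom.inr N N') fun x => by simp [Prod.norm_def])⟩

lemma ap_Kp (p : ℕ) [Fact p.Prime] : AP (Kp.{u} p) := by
  intro A B C f g hA hB hC hf hg
  obtain ⟨A, _, hA', rfl⟩ := exists_ofNormed A hA
  obtain ⟨B, _, hB', rfl⟩ := exists_ofNormed B hB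
  obtain ⟨C, _, hC', rfl⟩ := exists_ofNormed C hC
  obtain ⟨f', g', hf', hg', h⟩ := hA'.exists_amalgam hB' (toHom f)
    ((isometry_iff_norm f).1 hf.1) (toHom g) ((isometry_iff_norm g).1 hg.1)
  have hD := memKp_ofNormed (hC'.prod hB')
  exact ⟨ofNormed (C × B), _, _, hD, (isKEmb_iff hB hD _).2 (isometry_ofHom f' hf'),
    (isKEmb_iff hC hD _).2 (isometry_ofHom g' hg'), h⟩

lemma homogeneous_Kp (p : ℕ) [Fact p.Prime] : Homogeneous (Kp.{u} p) := by
  intro ι A B hA hB a b h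
  obtain ⟨A, _, hA', rfl⟩ := exists_ofNormed A hA
  obtain ⟨B, _, hB', rfl⟩ := exists_ofNormed B hB
  exact (sameGaloisType_iff hA' hB').2
    (normEq_of_finite fun n s => (sameGaloisType_iff hA' hB').1 (h n s))

end MAEC

/-! ### Groups with prescribed bases: the Löwenheim–Skolem number and monsters. -/

section Existence

variable {p : ℕ} [hp : Fact p.Prime]

/-- Every set indexes a basis of some group. -/
lemma exists_isPadic_basis (p : ℕ) [hp : Fact p.Prime] (κ : Type u) :
    ∃ (N : Type u) (_ : NormedAddCommGroup N) (e : κ → N), IsPadic p N ∧ IsPBasis p e := by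
  let W := WithPadic p (κ →₀ ℤ)
  let c : W →+ UniformSpace.Completion W := UniformSpace.Completion.toCompl
  let e : κ → UniformSpace.Completion W := fun i => c (Finsupp.single i (1 : ℤ))
  have hN : IsPadic p (UniformSpace.Completion W) :=
    IsPadic.completion (finsupp_eq_zero_of_prime_smul int_eq_zero_of_prime_smul)
  have hz : ∀ d, zcomb e d = c d := fun d => by
    have : zcomb e = c := by
      refine Finsupp.addHom_ext' fun i => ?_
      ext
      exact (zcomb_single e i 1).trans (one_smul _ _)
    exact DFunLike.congr_fun this d
  refine ⟨UniformSpace.Completion W, inferInstance, e, hN, fun d hd => ?_, ?_⟩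
  -- Passing to the completion creates no new divisibility by `p`, because divisibility is visible
  -- in the norm.
  · have h1 : ‖zcomb e d‖ ≤ (p : ℝ)⁻¹ ^ 1 := hN.norm_le_iff.2 (by simpa using hd)
    have h2 : ‖c d‖ = padicNormOf p d := UniformSpace.Completion.norm_coe (E := W) d
    rw [hz, h2, padicNormOf_le_iff] at h1
    simpa using h1
  · refine (UniformSpace.Completion.denseRange_coe (α := W)).mono ?_
    rintro _ ⟨d, rfl⟩
    exact ⟨d, hz d⟩

lemma IsPBasis.densityChar_le {N κ : Type u} [NormedAddCommGroup N] {e : κ → N}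
    (he : IsPBasis p e) : densityChar N ≤ max #κ ℵ₀ :=
  (densityChar_le_of_denseRange he.2).trans (mk_finsupp_int_le κ)

lemma PIndep.norm_eq_one {N κ : Type*} [NormedAddCommGroup N] (hN : IsPadic p N) {e : κ → N}
    (he : PIndep p e) (i : κ) : ‖e i‖ = 1 := by
  refine le_antisymm (hN.norm_le_one _) (not_lt.1 fun h => ?_)
  obtain ⟨y, hy⟩ := hN.exists_of_norm_lt_one h
  obtain ⟨c, hc⟩ := he (Finsupp.single i 1) ⟨y, by simpa using hy⟩
  have h2 : (p : ℤ) * c i = 1 := by simpa using DFunLike.congr_fun hc i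
  have h3 := Int.eq_one_or_neg_one_of_mul_eq_one h2
  have := hp.out.one_lt
  omega

lemma IsPadic.infinite_of_mem {N : Type u} [NormedAddCommGroup N] (hN : IsPadic p N)
    (S : AddSubgroup N) {x : N} (hx : x ∈ S) (hx0 : x ≠ 0) : Infinite S := by
  refine Infinite.of_injective (fun n : ℤ => (⟨n • x, S.zsmul_mem hx n⟩ : S)) fun n m h => ?_
  have h1 : (n - m) • x = 0 := by
    rw [sub_smul, sub_eq_zero]
    exact congrArg Subtype.val h
  by_contra hne
  refine hx0 ?_
  have := hN.mem_of_zsmul_mem (S := ⊥) (by simp) (fun y hy => by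
    simpa using hN.eq_zero y (by simpa using hy)) (sub_ne_zero.2 hne) (x := x) (by simpa using h1)
  simpa using this

lemma isLSNumber_Kp (p : ℕ) [Fact p.Prime] : IsLSNumber (Kp.{u} p) ℵ₀ := by
  refine ⟨fun _ hA C => exists_strong_of_subset hA C, fun μ hμ => ?_⟩
  -- Minimality: a submodel containing one nonzero element is infinite, so `ℵ₀ ≤ 1 + μ`, and `μ`
  -- cannot be finite.
  obtain ⟨N, _, e, hN, he⟩ := exists_isPadic_basis.{u} p PUnit
  obtain ⟨S, hS, -, hd⟩ := hμ (ofNormed N) (memKp_ofNormed hN) ({e ⟨⟩} : Set N)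
  have hne : e ⟨⟩ ≠ 0 := by
    rw [← norm_ne_zero_iff, he.1.norm_eq_one hN]
    exact one_ne_zero
  have hinf : Infinite S := hN.infinite_of_mem (toAddSubgroup S) (hS rfl) hne
  have h1 := (aleph0_le_densityChar S).trans hd
  rw [mk_singleton] at h1
  by_contra! h
  exact absurd (Cardinal.add_lt_aleph0 one_lt_aleph0 h) (not_lt.2 h1)

/-- Isometric homomorphisms from a small group into a group with an uncountable basis are
conjugate. -/
lemma IsPBasis.exists_automorphism {M A κ : Type u} [NormedAddCommGroup M] [NormedAddCommGroup A]
    (hM : IsPadic p M) (hA : IsPadic p A) {e : κ → M} (he : IsPBasis p e) (hκ : ℵ₀ < #κ)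
    (hd : densityChar A < #κ) (f g : A →+ M) (hf : ∀ x, ‖f x‖ = ‖x‖) (hg : ∀ x, ‖g x‖ = ‖x‖) :
    ∃ F : M ≃+ M, (∀ x, ‖F x‖ = ‖x‖) ∧ ∀ x, F (f x) = g x := by
  obtain ⟨ι, a, ha⟩ := hA.exists_basis
  have hι : #ι < #κ := (ha.1.mk_le hA).trans_lt hd
  have key : ∀ f : A →+ M, (∀ x, ‖f x‖ = ‖x‖) → ∃ (κ' : Type u) (e' : κ' → M),
      IsPBasis p (Sum.elim (f ∘ a) e') ∧ #κ' = #κ := by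
    intro f hf
    obtain ⟨κ', e', he'⟩ := hM.exists_extend_basis (e := f ∘ a) <|
      ha.1.map f fun x ⟨y, hy⟩ => by
        obtain ⟨z, rfl⟩ := (hA.range hM f hf).2 y ⟨x, hy.symm⟩
        exact ⟨z, (AddMonoidHomClass.isometry_of_norm f hf).injective (by rw [map_nsmul, hy])⟩
    refine ⟨κ', e', he', ?_⟩
    -- Comparison through the density character shows that any two bases have the same size once it
    -- is uncountable; since `ι` is smaller, the complement has size `#κ`.
    have h1 : #(ι ⊕ κ') ≤ #κ := (he'.1.mk_le hM).trans (he.densityChar_le.trans (by simp [hκ.le]))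
    have h2 : #κ ≤ max #(ι ⊕ κ') ℵ₀ := (he.1.mk_le hM).trans he'.densityChar_le
    have h3 : #κ ≤ #(ι ⊕ κ') := (le_max_iff.1 h2).resolve_right (not_le.2 hκ)
    have h4 : #ι + #κ' = #κ := by
      rw [← le_antisymm h1 h3, mk_sum, Cardinal.lift_id, Cardinal.lift_id]
    exact Cardinal.eq_of_add_eq_of_aleph0_le h4 hι hκ.le
  obtain ⟨κ₁, e₁, he₁, hc₁⟩ := key f hf
  obtain ⟨κ₂, e₂, he₂, hc₂⟩ := key g hg
  obtain ⟨σ⟩ := Cardinal.eq.1 (hc₁.trans hc₂.symm)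
  obtain ⟨F, hFc, hFe, hFn⟩ := he₁.exists_hom hM hM (Sum.elim (g ∘ a) (e₂ ∘ σ))
  have hind : PIndep p (Sum.elim (g ∘ a) (e₂ ∘ σ)) := by
    have := he₂.1.comp (s := Sum.map id σ) (Function.injective_id.sumMap σ.injective)
    rwa [Sum.elim_comp_map, Function.comp_id] at this
  have hFn := hFn hind
  have hsurj : Function.Surjective F := by
    refine he₂.surjective hM hM F hFn ?_
    rintro (i | i)
    · exact ⟨_, hFe (Sum.inl i)⟩
    · obtain ⟨j, rfl⟩ := σ.surjective i
      exact ⟨_, hFe (Sum.inr j)⟩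
  refine ⟨AddEquiv.ofBijective F ⟨(AddMonoidHomClass.isometry_of_norm F hFn).injective, hsurj⟩,
    hFn, fun x => ?_⟩
  have hfc : Continuous f := (AddMonoidHomClass.isometry_of_norm f hf).continuous
  have hgc : Continuous g := (AddMonoidHomClass.isometry_of_norm g hg).continuous
  refine ha.2.induction_on (p := fun x => F (f x) = g x) x
    (isClosed_eq (hFc.comp hfc) hgc) fun c => ?_
  rw [map_zcomb f, map_zcomb g]
  exact map_zcomb' F (fun i => hFe (Sum.inl i)) c

lemma exists_monster (p : ℕ) [Fact p.Prime] (lam : Cardinal.{u}) :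
    ∃ M, IsMonster (Kp.{u} p) lam M := by
  -- The rank has to exceed the density character of the hull of fewer than `lam` elements, and to
  -- be uncountable, whatever `lam` is.
  obtain ⟨κ, hκ⟩ : ∃ κ : Type u, #κ = Order.succ (max lam ℵ₀) := ⟨_, Cardinal.mk_out _⟩
  have h1 : max lam ℵ₀ < #κ := hκ ▸ Order.lt_succ _
  have hlam : lam < #κ := (le_max_left _ _).trans_lt h1
  have hal : ℵ₀ < #κ := (le_max_right _ _).trans_lt h1
  obtain ⟨M, _, e, hM, he⟩ := exists_isPadic_basis p κ
  refine ⟨ofNormed M, memKp_ofNormed hM, fun A hA hd => ?_, fun ι hι a b hab => ?_⟩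
  · obtain ⟨A, _, hA', rfl⟩ := exists_ofNormed A hA
    obtain ⟨κ', e', he'⟩ := hA'.exists_basis
    obtain ⟨s⟩ := (Cardinal.le_def _ _).1 ((he'.1.mk_le hA').trans (hd.le.trans hlam.le))
    obtain ⟨F, -, -, hF⟩ := he'.exists_hom hA' hM (e ∘ s)
    exact ⟨_, (isKEmb_iff hA (memKp_ofNormed hM) _).2
      (isometry_ofHom F (hF (he.1.comp s.injective)))⟩
  · obtain ⟨φ, hφ, hφa, -⟩ := ((sameGaloisType_iff hM hM).1 hab).exists_iso hM hM
    have hdc : densityChar (pcl p (range a : Set M)) < #κ := by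
      refine (densityChar_pcl_le hM _).trans_lt (Cardinal.add_lt_of_lt hal.le ?_ hal)
      exact mk_range_le.trans_lt (hι.trans hlam)
    obtain ⟨F, hF, hFφ⟩ := he.exists_automorphism hM (isPadic_pcl hM (range a)) hal hdc
      (pcl p (range a)).subtype φ (fun _ => rfl) hφ
    refine ⟨ofAddEquiv F, isometry_ofAddEquiv F hF, fun i => ?_⟩
    exact (hFφ ⟨a i, subset_pcl _ ⟨i, rfl⟩⟩).trans (hφa i _)

end Existence

/-! ### Galois types in a monster model -/

section Monster

variable {p : ℕ} [hp : Fact p.Prime] {M : Type u} [NormedAddCommGroup M] {lam : Cardinal.{u}}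

lemma tg_eq_iff {ι : Type} {a b : ι → M} {A : Set M} :
    tg (M := ofNormed M) a A = tg (M := ofNormed M) b A ↔
      ∃ F : M →+ M, (∀ x, ‖F x‖ = ‖x‖) ∧ Function.Surjective F ∧ (∀ x ∈ A, F x = x) ∧
        ∀ i, F (a i) = b i := by
  refine Quotient.eq.trans ⟨?_, ?_⟩
  · rintro ⟨F, hF, hA, hab⟩
    exact ⟨toHom F.toEmbedding, (isometry_iff_norm F.toEmbedding).1 hF, F.surjective, hA, hab⟩
  · rintro ⟨F, hF, hs, hA, hab⟩
    exact ⟨ofAddEquiv (AddEquiv.ofBijective F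
      ⟨(AddMonoidHomClass.isometry_of_norm F hF).injective, hs⟩), isometry_ofAddEquiv _ hF, hA, hab⟩

lemma tg_eq_of_subset_closure {ι : Type} {a b : ι → M} {A B : Set M} (hAB : B ⊆ closure A)
    (h : tg (M := ofNormed M) a A = tg (M := ofNormed M) b A) :
    tg (M := ofNormed M) a B = tg (M := ofNormed M) b B := by
  obtain ⟨F, hF, hs, hA, hab⟩ := tg_eq_iff.1 h
  have hc : Continuous F := (AddMonoidHomClass.isometry_of_norm F hF).continuous
  have : IsClosed {x | F x = x} := isClosed_eq hc continuous_id
  exact tg_eq_iff.2 ⟨F, hF, hs, fun x hx => closure_minimal hA this (hAB hx), hab⟩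

/-- The fixed points of `F` form a closed pure subgroup. -/
lemma eq_of_mem_pcl (hM : IsPadic p M) {F : M →+ M} (hF : ∀ x, ‖F x‖ = ‖x‖) {A : Set M}
    (hA : ∀ x ∈ A, F x = x) {x : M} (hx : x ∈ pcl p A) : F x = x := by
  have hc : Continuous F := (AddMonoidHomClass.isometry_of_norm F hF).continuous
  have h1 : IsClosed ((F.eqLocus (AddMonoidHom.id M) : AddSubgroup M) : Set M) :=
    isClosed_eq hc continuous_id
  exact pcl_le (S := F.eqLocus (AddMonoidHom.id M)) h1
    (fun y hy => smul_injective_of hM.eq_zero ((map_nsmul F p y).symm.trans hy)) hA hx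

/-- A point of the closure is the limit of a sequence, and each term needs only finitely many
generators. This provides the countable base set for simplicity. -/
lemma mem_pcl_countable {A : Set M} {x : M} (hx : x ∈ pcl p A) :
    ∃ C ⊆ A, C.Countable ∧ x ∈ pcl p C := by
  have hcl : ∀ y ∈ AddSubgroup.closure A, ∃ C ⊆ A, C.Countable ∧ y ∈ AddSubgroup.closure C := by
    intro y hy
    induction hy using AddSubgroup.closure_induction with
    | mem y hy => exact ⟨{y}, singleton_subset_iff.2 hy, countable_singleton y,
        AddSubgroup.subset_closure rfl⟩
    | zero => exact ⟨∅, empty_subset _, countable_empty, zero_mem _⟩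
    | add y z _ _ hy hz =>
      obtain ⟨C, hC, hCc, hy⟩ := hy
      obtain ⟨D, hD, hDc, hz⟩ := hz
      exact ⟨C ∪ D, union_subset hC hD, hCc.union hDc,
        add_mem (AddSubgroup.closure_mono subset_union_left hy)
          (AddSubgroup.closure_mono subset_union_right hz)⟩
    | neg y _ hy =>
      obtain ⟨C, hC, hCc, hy⟩ := hy
      exact ⟨C, hC, hCc, neg_mem hy⟩
  have hx' : x ∈ closure (hull p A : Set M) := hx
  obtain ⟨u, hu, hux⟩ := mem_closure_iff_seq_limit.1 hx'
  choose k hk using hu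
  choose C hC hCc hmem using fun n => hcl _ (hk n)
  refine ⟨⋃ n, C n, iUnion_subset hC, countable_iUnion hCc, ?_⟩
  refine mem_closure_of_tendsto hux (Filter.Eventually.of_forall fun n => ?_)
  exact ⟨k n, AddSubgroup.closure_mono (subset_iUnion C n) (hmem n)⟩

/-! ### Universality and homogeneity of a monster in terms of norms. -/

section

variable (hM : IsPadic p M) (hmon : IsMonster (Kp p) lam (ofNormed M)) (hl : ℵ₀ < lam)
include hM hmon

lemma exists_automorphism_of_normEq {ι : Type u} (hι : #ι < lam) {a b : ι → M}
    (h : NormEq a b) : ∃ F : M →+ M, (∀ x, ‖F x‖ = ‖x‖) ∧ Function.Surjective F ∧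
      ∀ i, F (a i) = b i := by
  obtain ⟨F, hF, hab⟩ := hmon.homogeneous ι hι a b ((sameGaloisType_iff hM hM).2 h)
  exact ⟨toHom F.toEmbedding, (isometry_iff_norm F.toEmbedding).1 hF, F.surjective, hab⟩

include hl

/-- Appending an enumeration of `A` to both tuples forces the automorphism given by homogeneity to
fix `A` pointwise. -/
lemma tg_eq_of_normEq {ι : Type} [Countable ι] {a b : ι → M} {A : Set M} (hA : #A < lam)
    (h : NormEq (Sum.elim (fun i : ULift.{u} ι => a i.down) ((↑) : A → M))
      (Sum.elim (fun i : ULift.{u} ι => b i.down) ((↑) : A → M))) :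
    tg (M := ofNormed M) a A = tg (M := ofNormed M) b A := by
  have hι : #(ULift.{u} ι ⊕ A) < lam := by
    rw [mk_sum, Cardinal.lift_id, Cardinal.lift_id]
    exact Cardinal.add_lt_of_lt hl.le (mk_le_aleph0.trans_lt hl) hA
  obtain ⟨F, hF, hs, hab⟩ := exists_automorphism_of_normEq hM hmon hι h
  exact tg_eq_iff.2 ⟨F, hF, hs, fun x hx => hab (Sum.inr ⟨x, hx⟩), fun i => hab (Sum.inl ⟨i⟩)⟩

lemma tg_eq_of_norm {ι : Type} [Countable ι] {a b : ι → M} {A : Set M} (hA : #A < lam)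
    (h : ∀ c, ∀ r ∈ AddSubgroup.closure A, ‖zcomb a c + r‖ = ‖zcomb b c + r‖) :
    tg (M := ofNormed M) a A = tg (M := ofNormed M) b A := by
  refine tg_eq_of_normEq hM hmon hl hA fun c => ?_
  have hdown : ∀ (a : ι → M) (d : ULift.{u} ι →₀ ℤ),
      zcomb (fun i : ULift.{u} ι => a i.down) d = zcomb a (d.mapDomain ULift.down) := fun a d =>
    (zcomb_mapDomain a ULift.down d).symm
  rw [zcomb_sumElim, zcomb_sumElim, hdown, hdown]
  refine h _ _ ?_
  simpa using zcomb_mem_closure ((↑) : A → M) _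

/-- Over a small closed pure subgroup there are free copies of all small groups. -/
lemma exists_free_hom {P : AddSubgroup M} (hP : IsPadic p P) (hPd : densityChar P < lam)
    {N : Type u} [NormedAddCommGroup N] (hN : IsPadic p N) (hNd : densityChar N < lam) :
    ∃ h : N →+ M, ∀ r ∈ P, ∀ x, ‖r + h x‖ = max ‖r‖ ‖x‖ := by
  have hd : densityChar (P × N) < lam :=
    (densityChar_prod_le P N).trans_lt (Cardinal.mul_lt_of_lt hl.le hPd hNd)
  -- Universality yields a free copy of `N` over some copy of `P`; an isometric automorphism then
  -- moves that copy onto `P`.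
  obtain ⟨f, hf⟩ := hmon.universal (ofNormed (P × N)) (memKp_ofNormed (hP.prod hN)) hd
  have hfn := (isometry_iff_norm f).1 hf.1
  -- Only the density character of `P` is below `lam`, so homogeneity is applied to a dense subset
  -- and the result is extended by continuity.
  obtain ⟨D, hD, hDc⟩ := exists_dense_card_eq P
  let g : P →+ M := (toHom f).comp (AddMonoidHom.inl P N)
  have hg : ∀ r, ‖g r‖ = ‖r‖ := fun r => (hfn (r, 0)).trans (by simp [Prod.norm_def])
  have hne : NormEq (fun d : D => g d) (fun d : D => ((d : P) : M)) := by
    intro c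
    have h1 := normEq_of_hom (a := fun d : D => (d : P)) g hg (fun _ => rfl) c
    have h2 := normEq_of_hom (a := fun d : D => (d : P)) P.subtype (fun _ => rfl) (fun _ => rfl) c
    exact h1.symm.trans h2
  obtain ⟨F, hF, -, hFd⟩ := exists_automorphism_of_normEq hM hmon (hDc ▸ hPd) hne
  have hFg : ∀ r : P, F (g r) = r := by
    have hgc : Continuous g := (AddMonoidHomClass.isometry_of_norm g hg).continuous
    have hFc : Continuous F := (AddMonoidHomClass.isometry_of_norm F hF).continuous
    have := Continuous.ext_on hD (hFc.comp hgc) continuous_subtype_val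
      (fun d hd => hFd ⟨d, hd⟩)
    exact fun r => congrFun this r
  refine ⟨F.comp ((toHom f).comp (AddMonoidHom.inr P N)), fun r hr x => ?_⟩
  have h1 : F (toHom f (⟨r, hr⟩, x)) = r + F (toHom f (0, x)) := by
    have h2 : ((⟨r, hr⟩, x) : P × N) = (⟨r, hr⟩, 0) + (0, x) := by simp
    rw [h2, map_add, map_add]
    congr 1
    exact hFg ⟨r, hr⟩
  change ‖r + F (toHom f (0, x))‖ = _
  rw [← h1, hF, hfn]
  rfl

end

/-- Replacing the component of a tuple outside `P` by a free copy does not change the type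
over `P`. -/
lemma norm_zcomb_free (hM : IsPadic p M) {P : AddSubgroup M} (hP : IsPadic p P) {ρ : M →+ P}
    (hρ : ∀ x : P, ρ x = x) {N : Type*} [NormedAddCommGroup N] {R : AddSubgroup M} (hPR : P ≤ R)
    {h : N →+ M} (hh : ∀ r ∈ R, ∀ x, ‖r + h x‖ = max ‖r‖ ‖x‖) {ι : Type*} {a : ι → M} {y : ι → N}
    (hy : NormEq y (fun i => a i - ρ (a i))) (c : ι →₀ ℤ) {r : M} (hr : r ∈ P) :
    ‖zcomb a c + r‖ = ‖zcomb (fun i => (ρ (a i) : M) + h (y i)) c + r‖ := by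
  let π : M →+ M := P.subtype.comp ρ
  have hπr : π r = r := congrArg Subtype.val (hρ ⟨r, hr⟩)
  have h1 : π (zcomb a c + r) = zcomb (fun i => (ρ (a i) : M)) c + r := by
    rw [map_add, map_zcomb, hπr]
    rfl
  have h2 : zcomb a c = zcomb (fun i => (ρ (a i) : M)) c + zcomb (fun i => a i - ρ (a i)) c := by
    rw [← zcomb_add_family]
    congr
    funext i
    abel
  have h3 : zcomb a c + r - π (zcomb a c + r) = zcomb (fun i => a i - ρ (a i)) c := by
    rw [h1, h2]
    abel
  -- The norm is the maximum of the component in `P` and the component outside. The free copy has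
  -- the same first component, and its second one has the same norm by `hy`.
  have h4 := hP.norm_eq_max hM (f := P.subtype) (fun _ => rfl) ρ (zcomb a c + r)
  have h5 : ‖zcomb a c + r‖ = max ‖π (zcomb a c + r)‖ ‖zcomb a c + r - π (zcomb a c + r)‖ := h4
  have h6 : π (zcomb a c + r) ∈ R := hPR (ρ (zcomb a c + r)).2
  rw [h5, h3, ← hy c, ← hh _ h6, h1, zcomb_add_family, ← map_zcomb' h (fun i => rfl) c]
  congr 1
  abel

/-! ### Perturbations and stability -/

lemma dp_le {A : Set M} {n : ℕ} (a b : Fin n → M) :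
    dp (tg (M := ofNormed M) a A) (tg (M := ofNormed M) b A) ≤ dist a b := by
  refine csInf_le ⟨0, ?_⟩ ⟨a, b, rfl, rfl, rfl⟩
  rintro _ ⟨a, b, -, -, rfl⟩
  exact dist_nonneg

lemma exists_of_dp_lt {A : Set M} {n : ℕ} {q r : GType (ofNormed M) A (Fin n)} {ε : ℝ}
    (h : dp q r < ε) : ∃ a b : Fin n → M, tg (M := ofNormed M) a A = q ∧
      tg (M := ofNormed M) b A = r ∧ dist a b < ε := by
  obtain ⟨a₀, ha₀⟩ := Quotient.exists_rep q
  obtain ⟨b₀, hb₀⟩ := Quotient.exists_rep r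
  have hne : {t : ℝ | ∃ a b : Fin n → ofNormed M, tg a A = q ∧ tg b A = r ∧
    t = dist a b}.Nonempty := ⟨_, a₀, b₀, ha₀, hb₀, rfl⟩
  obtain ⟨_, ⟨a, b, ha, hb, rfl⟩, hlt⟩ := exists_lt_of_csInf_lt hne h
  exact ⟨a, b, ha, hb, hlt⟩

lemma norm_zcomb_le (hM : IsPadic p M) {ι : Type*} {v : ι → M} {ε : ℝ} (hε : 0 ≤ ε)
    (hv : ∀ i, ‖v i‖ ≤ ε) (c : ι →₀ ℤ) : ‖zcomb v c‖ ≤ ε := by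
  induction c using Finsupp.induction_linear with
  | zero => simpa using hε
  | add c d hc hd =>
    rw [map_add]
    exact (hM.norm_add_le_max _ _).trans (max_le hc hd)
  | single i n =>
    rw [zcomb_single]
    exact (hM.norm_map_le hM (zsmulAddGroupHom n) (v i)).trans (hv i)

lemma normEq_of_tg_eq {ι : Type} {a b : ι → M} {A : Set M}
    (h : tg (M := ofNormed M) a A = tg (M := ofNormed M) b A) : NormEq a b := by
  obtain ⟨F, hF, -, -, hab⟩ := tg_eq_iff.1 h
  exact normEq_of_hom F hF hab

/-- By the ultrametric inequality, tuples at distance below `ε` have combinations whose norms differ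
by at most `ε`; at distance `0` the norms agree. -/
lemma perturbationProperty (hM : IsPadic p M) (hmon : IsMonster (Kp p) lam (ofNormed M))
    (hl : ℵ₀ < lam) : PerturbationProperty (ofNormed M) := by
  intro n a b h
  have hne : NormEq (N := M) (N' := M) a b := fun c => by
    refine eq_of_abs_sub_le_all fun ε hε => ?_
    obtain ⟨a', b', ha, hb, hd⟩ := exists_of_dp_lt (h.trans_lt hε)
    rw [← normEq_of_tg_eq ha c, ← normEq_of_tg_eq hb c]
    refine (abs_norm_sub_norm_le _ _).trans ?_
    have h1 : zcomb a' c - zcomb b' c = zcomb (fun i => a' i - b' i) c := by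
      have : a' = fun i => b' i + (a' i - b' i) := by
        funext i
        abel
      rw [sub_eq_iff_eq_add', ← zcomb_add_family, ← this]
    rw [h1]
    refine norm_zcomb_le hM hε.le (fun i => ?_) c
    rw [← dist_eq_norm]
    exact (dist_le_pi_dist a' b' i).trans hd.le
  refine tg_eq_of_norm hM hmon hl ?_ fun c r hr => ?_
  · rw [mk_eq_zero]
    exact aleph0_pos.trans hl
  · rw [AddSubgroup.closure_empty, AddSubgroup.mem_bot] at hr
    rw [hr, add_zero, add_zero]
    exact hne c

/-- A type at distance below `p⁻¹ ^ k` from that of `(p ^ k • e, …, p ^ k • e)` has first coordinate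
of norm exactly `p⁻¹ ^ k`, so different `k` need different members of `T`. -/
lemma aleph0_le_of_dense_types (hM : IsPadic p M) {A : Set M} {n : ℕ} (hn : n ≠ 0) {e : M}
    (he : ‖e‖ = 1) {T : Set (GType (ofNormed M) A (Fin n))}
    (hT : ∀ q, ∀ ε > 0, ∃ r ∈ T, dp q r < ε) : ℵ₀ ≤ #T := by
  have hp0 := inv_prime_pos p
  choose r hrT hr using fun k : ℕ =>
    hT (tg (M := ofNormed M) (fun _ => (p ^ k • e : M)) A) ((p : ℝ)⁻¹ ^ k) (by positivity)
  let i₀ : Fin n := ⟨0, Nat.pos_of_ne_zero hn⟩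
  have key : ∀ k, ∃ b : Fin n → M, tg (M := ofNormed M) b A = r k ∧ ‖b i₀‖ = (p : ℝ)⁻¹ ^ k := by
    intro k
    obtain ⟨a, b, ha, hb, hd⟩ := exists_of_dp_lt (hr k)
    have h1 : ‖a i₀‖ = (p : ℝ)⁻¹ ^ k := by
      have := normEq_of_tg_eq ha (Finsupp.single i₀ 1)
      rw [zcomb_single, zcomb_single, one_smul, one_smul, hM.norm_pow_smul, he, mul_one] at this
      exact this
    have h2 : ‖a i₀ - b i₀‖ < (p : ℝ)⁻¹ ^ k := by
      rw [← dist_eq_norm]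
      exact (dist_le_pi_dist a b i₀).trans_lt hd
    refine ⟨b, hb, le_antisymm ?_ (not_lt.1 fun h3 => ?_)⟩
    · have := hM.norm_sub_le_max (a i₀) (a i₀ - b i₀)
      rw [sub_sub_cancel] at this
      exact this.trans (max_le h1.le h2.le)
    · have := hM.norm_add_le_max (a i₀ - b i₀) (b i₀)
      rw [sub_add_cancel, h1] at this
      exact absurd this (not_le.2 (max_lt h2 h3))
  have hinj : Function.Injective fun k : ULift.{u} ℕ => (⟨r k.down, hrT k.down⟩ : T) := by
    rintro ⟨k⟩ ⟨m⟩ hkm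
    have hkm' : r k = r m := congrArg Subtype.val hkm
    obtain ⟨b, hb, hbn⟩ := key k
    obtain ⟨b', hb', hbn'⟩ := key m
    have := normEq_of_tg_eq (hb.trans (hkm'.trans hb'.symm)) (Finsupp.single i₀ 1)
    rw [zcomb_single, zcomb_single, one_smul, one_smul, hbn, hbn'] at this
    have := (pow_right_strictAnti₀ hp0 (inv_prime_lt_one p)).injective this
    rw [this]
  simpa using mk_le_of_injective hinj

lemma omegaDPStable (hM : IsPadic p M) (hmon : IsMonster (Kp p) lam (ofNormed M))
    (hl : ℵ₀ < lam) : OmegaDPStable (ofNormed M) := by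
  intro A hA n hn
  obtain ⟨D, hD, hDc⟩ := exists_dense_card_eq A
  let A₀ : Set M := Subtype.val '' D
  have hA₀ : #A₀ ≤ ℵ₀ := mk_image_le.trans (hDc.trans_le hA)
  have hAA : A ⊆ closure A₀ := by
    intro x hx
    have := image_closure_subset_closure_image (s := D) (continuous_subtype_val (p := (· ∈ A)))
    exact this ⟨⟨x, hx⟩, hD _, rfl⟩
  have hP := isPadic_pcl hM A₀
  have hPd : densityChar (pcl p A₀) ≤ ℵ₀ :=
    (densityChar_pcl_le hM A₀).trans (by simp [hA₀])
  -- Countable rank suffices to contain a copy of the closed pure hull of any finite tuple.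
  obtain ⟨N, _, e, hN, he⟩ := exists_isPadic_basis.{u} p (ULift.{u} ℕ)
  have hNd : densityChar N ≤ ℵ₀ := he.densityChar_le.trans (by simp)
  obtain ⟨h, hh⟩ := exists_free_hom hM hmon hl hP (hPd.trans_lt hl) hN (hNd.trans_lt hl)
  have hhn : ∀ x, ‖h x‖ = ‖x‖ := fun x => by
    have := hh 0 (zero_mem _) x
    rwa [zero_add, norm_zero, max_eq_right (norm_nonneg x)] at this
  obtain ⟨ρ, hρ⟩ := hP.exists_leftInverse hM (pcl p A₀).subtype (fun _ => rfl)
  obtain ⟨E, hE, hEc⟩ := exists_dense_card_eq (pcl p A₀ × N)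
  have hE0 : #E ≤ ℵ₀ := by
    rw [hEc]
    exact (densityChar_prod_le _ _).trans ((mul_le_mul' hPd hNd).trans (by simp))
  let t : (Fin n → E) → GType (ofNormed M) A (Fin n) := fun x =>
    tg (M := ofNormed M) (fun i => ((x i).1.1 : M) + h (x i).1.2) A
  have hdense : ∀ q, ∀ ε > 0, ∃ r ∈ range t, dp q r < ε := by
    intro q ε hε
    obtain ⟨a, rfl⟩ := Quotient.exists_rep q
    let a' : Fin n → M := fun i => a i - ρ (a i)
    obtain ⟨κ, d, hd⟩ := (isPadic_pcl hM (range a')).exists_basis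
    have hκ : #κ ≤ #(ULift.{u} ℕ) := by
      refine (hd.1.mk_le (isPadic_pcl hM (range a'))).trans ((densityChar_pcl_le hM _).trans ?_)
      have : #(range a') ≤ ℵ₀ := (countable_range a').le_aleph0
      simp [this]
    obtain ⟨s⟩ := (Cardinal.le_def _ _).1 hκ
    obtain ⟨θ, -, -, hθ⟩ := hd.exists_hom (isPadic_pcl hM (range a')) hN (e ∘ s)
    have hθ := hθ (he.1.comp s.injective)
    let y : Fin n → N := fun i => θ ⟨a' i, subset_pcl _ ⟨i, rfl⟩⟩
    have hy : NormEq y a' := by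
      have h1 := normEq_of_hom (a := fun i => (⟨a' i, subset_pcl _ ⟨i, rfl⟩⟩ : pcl p (range a')))
        θ hθ (b := y) (fun _ => rfl)
      have h2 := normEq_of_hom (a := fun i => (⟨a' i, subset_pcl _ ⟨i, rfl⟩⟩ : pcl p (range a')))
        (pcl p (range a')).subtype (fun _ => rfl) (b := a') (fun _ => rfl)
      exact h1.symm.trans h2
    have htg : tg (M := ofNormed M) a A =
        tg (M := ofNormed M) (fun i => (ρ (a i) : M) + h (y i)) A :=
      tg_eq_of_subset_closure hAA <| tg_eq_of_norm hM hmon hl (hA₀.trans_lt hl) fun c r hr =>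
        norm_zcomb_free hM hP hρ le_rfl hh hy c (closure_le_pcl A₀ hr)
    -- The tuple now depends isometrically on its coordinates in the separable group `pcl p A₀ × N`,
    -- so approximating these approximates the type.
    choose x hxE hx using fun i => hE.exists_dist_lt (ρ (a i), y i) hε
    refine ⟨_, ⟨fun i => ⟨x i, hxE i⟩, rfl⟩, ?_⟩
    change dp (tg (M := ofNormed M) a A) _ < ε
    rw [htg]
    refine (dp_le _ _).trans_lt ((dist_pi_lt_iff hε).2 fun i => ?_)
    rw [dist_eq_norm, add_sub_add_comm, ← map_sub]
    have h1 := hx i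
    rw [dist_eq_norm, Prod.norm_def, max_lt_iff] at h1
    refine (hM.norm_add_le_max _ _).trans_lt (max_lt h1.1 ?_)
    rw [hhn]
    exact h1.2
  have hT : #(range t) ≤ ℵ₀ := by
    have : Countable E := mk_le_aleph0_iff.1 hE0
    exact (countable_range t).le_aleph0
  have he1 : ‖h (e ⟨0⟩)‖ = 1 := by rw [hhn, he.1.norm_eq_one hN]
  have hmem : #(range t) ∈ {μ | ∃ T : Set (GType (ofNormed M) A (Fin n)),
    (∀ q, ∀ ε > 0, ∃ r ∈ T, dp q r < ε) ∧ #T = μ} := ⟨range t, hdense, rfl⟩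
  refine le_antisymm ((csInf_le' hmem).trans hT) (le_csInf ⟨_, hmem⟩ ?_)
  rintro _ ⟨T, hT, rfl⟩
  exact aleph0_le_of_dense_types hM hn he1 hT

end Monster

/-! ### Strong splitting and simplicity -/

section Simplicity

variable {p : ℕ} [hp : Fact p.Prime] {M : Type u} [NormedAddCommGroup M] {lam : Cardinal.{u}}

/-- Subsequences of length one are all of indiscernibility that the arguments against strong
splitting use. -/
lemma Indiscernible.exists_map {m : ℕ} {b : ℕ → Fin m → M} {C : Set M}
    (h : Indiscernible (M := ofNormed M) b C) :
    ∃ F : M →+ M, (∀ x, ‖F x‖ = ‖x‖) ∧ (∀ x ∈ C, F x = x) ∧ ∀ j, F (b 1 j) = b 0 j := by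
  obtain ⟨F, hF, -, hC, hab⟩ := tg_eq_iff.1 (h 1 (fun _ => 1) (Subsingleton.strictMono _))
  exact ⟨F, hF, hC, fun j => hab (0, j)⟩

lemma SplitsStrongly.not_subset {n : ℕ} {a : Fin n → M} {D C : Set M}
    (h : SplitsStrongly (M := ofNormed M) a D C) : ¬ D ⊆ C := by
  rintro hDC
  obtain ⟨m, b, hb, -, h1, hne⟩ := h
  obtain ⟨F, -, hC, hF⟩ := hb.exists_map
  refine hne ?_
  have : b 0 = b 1 := funext fun j => (hF j).symm.trans (hC _ (hDC (h1 j)))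
  rw [this]

/-- Strong splitting makes each step of the chain strict, so after `lam` steps the set has at least
`lam` elements, which is not allowed. Thus `kappa` is an infimum over a nonempty set. -/
lemma not_hasStronglySplittingSeq_succ :
    ¬ HasStronglySplittingSeq (ofNormed M) lam (Order.succ lam) := by
  rintro ⟨n, a, A, hA, h⟩
  have hlt : ∀ i : Iio lam.ord, i.1 < (Order.succ lam).ord := fun i =>
    i.2.trans (ord_lt_ord.2 (Order.lt_succ lam))
  have hex : ∀ i : Iio lam.ord, ∃ x ∈ A (Order.succ i.1), x ∉ A i.1 := fun i =>
    not_subset.1 (h i.1 (hlt i)).2.not_subset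
  choose x hx hx' using hex
  have hmem : ∀ i, x i ∈ A (Order.succ lam.ord) := fun i =>
    hA (Order.succ_le_succ (le_of_lt i.2)) (hx i)
  have hinj : Function.Injective fun i => (⟨x i, hmem i⟩ : A (Order.succ lam.ord)) := by
    have key : ∀ i j : Iio lam.ord, i < j → x i ≠ x j := fun i j hij heq =>
      hx' j (heq ▸ hA (Order.succ_le_of_lt (Subtype.coe_lt_coe.2 hij)) (hx i))
    intro i j hij
    have hij' : x i = x j := congrArg Subtype.val hij
    rcases lt_trichotomy i j with h | h | h
    · exact absurd hij' (key i j h)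
    · exact h
    · exact absurd hij'.symm (key j i h)
  have h1 := Cardinal.lift_mk_le_lift_mk_of_injective hinj
  rw [Cardinal.mk_Iio_ordinal, card_ord, Cardinal.lift_lift, Cardinal.lift_le] at h1
  exact absurd (h lam.ord (ord_lt_ord.2 (Order.lt_succ lam))).1 (not_lt.2 h1)

lemma PIndep.normEq_comp (hM : IsPadic p M) {κ ι : Type*} {e : κ → M} (he : PIndep p e)
    {s t : ι → κ} (hs : Function.Injective s) (ht : Function.Injective t) :
    NormEq (e ∘ s) (e ∘ t) := fun c => by
  rw [(he.comp hs).norm_zcomb hM, (he.comp ht).norm_zcomb hM]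

lemma exists_limit_sum (hM : IsPadic p M) (u : ℕ → M) :
    ∃ a : M, ∀ k, ‖a - ∑ j ∈ Finset.range k, p ^ j • u j‖ ≤ (p : ℝ)⁻¹ ^ k := by
  have := hM.complete
  have hlt := inv_prime_lt_one p
  let s : ℕ → M := fun k => ∑ j ∈ Finset.range k, p ^ j • u j
  have hs : ∀ k, dist (s k) (s (k + 1)) ≤ 1 * (p : ℝ)⁻¹ ^ k := fun k => by
    rw [dist_comm, dist_eq_norm, one_mul, hM.norm_le_iff]
    exact ⟨u k, by simp [s, Finset.sum_range_succ]⟩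
  obtain ⟨a, ha⟩ := cauchySeq_tendsto_of_complete (cauchySeq_of_le_geometric _ _ hlt hs)
  refine ⟨a, fun k => ?_⟩
  have hm : ∀ m, ‖s (k + m) - s k‖ ≤ (p : ℝ)⁻¹ ^ k := fun m => by
    induction m with
    | zero =>
      rw [add_zero, sub_self, norm_zero]
      exact pow_nonneg (inv_prime_pos p).le k
    | succ m ih =>
      have h1 : s (k + (m + 1)) - s k = p ^ (k + m) • u (k + m) + (s (k + m) - s k) := by
        simp only [s, ← add_assoc, Finset.sum_range_succ]
        abel
      rw [h1]
      refine (hM.norm_add_le_max _ _).trans (max_le ?_ ih)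
      rw [hM.norm_le_iff]
      exact ⟨p ^ m • u (k + m), by rw [smul_smul, ← pow_add]⟩
  refine le_of_tendsto ((ha.comp (Filter.tendsto_add_atTop_nat k)).sub_const (s k)).norm
    (Filter.Eventually.of_forall fun m => ?_)
  rw [Function.comp_apply, add_comm m k]
  exact hm m

/-! ### The bound `κ(K_p) > ℵ₀`, and simplicity. -/

section

variable (hM : IsPadic p M) (hmon : IsMonster (Kp p) lam (ofNormed M)) (hl : ℵ₀ < lam)
include hM hmon hl

lemma exists_pIndep_nat : ∃ e : ℕ → M, PIndep p e := by
  obtain ⟨N, _, e, hN, he⟩ := exists_isPadic_basis.{u} p (ULift.{u} ℕ)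
  have hNd : densityChar N ≤ ℵ₀ := he.densityChar_le.trans (by simp)
  obtain ⟨f, hf⟩ := hmon.universal (ofNormed N) (memKp_ofNormed hN) (hNd.trans_lt hl)
  have hfn := (isometry_iff_norm f).1 hf.1
  refine ⟨(toHom f ∘ e) ∘ ULift.up, (he.1.map (toHom f) ?_).comp ULift.up_injective⟩
  rintro x ⟨y, hy⟩
  obtain ⟨z, rfl⟩ := (hN.range hM (toHom f) hfn).2 y ⟨x, hy.symm⟩
  exact ⟨z, f.injective ((map_nsmul (toHom f) p z).trans hy)⟩

/-- Any two injective enumerations from an independent family have combinations of equal norm. The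
bound `l` keeps the sequence disjoint from the parameters. -/
lemma indiscernible_shift {e : ℕ → M} (he : PIndep p e) (I : Set ℕ) (l : ℕ) (hI : ∀ i ∈ I, i < l) :
    Indiscernible (M := ofNormed M) (fun i (_ : Fin 1) => e (l + i)) (e '' I) := by
  intro n s hs
  choose idx hidx hidxe using fun x : e '' I => x.2
  have hA : #(e '' I) < lam := ((to_countable I).image e).le_aleph0.trans_lt hl
  have hinj : ∀ s : Fin n → ℕ, Function.Injective s → Function.Injective
      (Sum.elim (fun k : ULift.{u} (Fin n × Fin 1) => l + s k.down.1) idx) := by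
    intro s hs
    refine Function.Injective.sumElim ?_ ?_ ?_
    · rintro ⟨i, i'⟩ ⟨j, j'⟩ hij
      have h1 : i = j := hs (Nat.add_left_cancel hij)
      rw [h1, Subsingleton.elim i' j']
    · intro x y hxy
      refine Subtype.ext ?_
      rw [← hidxe x, ← hidxe y, hxy]
    · intro i x hix
      have := hI _ (hidx x)
      omega
  have key : ∀ s : Fin n → ℕ, Sum.elim (fun k : ULift.{u} (Fin n × Fin 1) => e (l + s k.down.1))
      ((↑) : e '' I → M) = e ∘ Sum.elim (fun k => l + s k.down.1) idx := fun s => by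
    funext i
    rcases i with i | i
    · rfl
    · exact (hidxe i).symm
  refine tg_eq_of_normEq hM hmon hl hA ?_
  have h1 := he.normEq_comp hM (hinj s hs.injective) (hinj (fun i => i) Fin.val_injective)
  rw [← key, ← key] at h1
  exact h1

/-- An isometry that fixes `a` and the first `2 * k` vectors and sends `e (2 * k)` to `e (2 * k +
1)` would make `p ^ k • (e (2 * k) - e (2 * k + 1))` divisible by `p ^ (k + 1)`. The odd vectors do
not occur in `a`; they serve as the second terms of the indiscernible sequences. -/
lemma splitsStrongly_of_limit {e : ℕ → M} (he : PIndep p e) {a : M}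
    (ha : ∀ k, ‖a - ∑ j ∈ Finset.range k, p ^ j • e (2 * j)‖ ≤ (p : ℝ)⁻¹ ^ k) (k : ℕ) :
    SplitsStrongly (M := ofNormed M) (fun _ : Fin 1 => a) (e '' {j | j < 2 * (k + 1)})
      (e '' {j | j < 2 * k}) := by
  refine ⟨1, fun i _ => e (2 * k + i), indiscernible_shift hM hmon hl he _ _ fun i hi => hi,
    fun j => ⟨2 * k + 0, ?_, rfl⟩, fun j => ⟨2 * k + 1, ?_, rfl⟩, fun h => ?_⟩
  · change 2 * k + 0 < 2 * (k + 1)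
    omega
  · change 2 * k + 1 < 2 * (k + 1)
    omega
  obtain ⟨F, hF, -, hFC, hFe⟩ := tg_eq_iff.1 h
  have h1 : F a = a := hFe (Sum.inl 0)
  have h2 : F (e (2 * k)) = e (2 * k + 1) := hFe (Sum.inr 0)
  have h3 : F (∑ j ∈ Finset.range k, p ^ j • e (2 * j)) =
      ∑ j ∈ Finset.range k, p ^ j • e (2 * j) := by
    rw [map_sum]
    refine Finset.sum_congr rfl fun j hj => ?_
    rw [map_nsmul, hFC]
    refine ⟨2 * j, ?_, rfl⟩
    have := Finset.mem_range.1 hj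
    change 2 * j < 2 * k
    omega
  have h4 := ha (k + 1)
  have h5 := h4
  rw [← hF, map_sub, Finset.sum_range_succ, map_add, h1, h3, map_nsmul, h2] at h5
  rw [Finset.sum_range_succ] at h4
  have h6 := (hM.norm_sub_le_max _ _).trans (max_le h5 h4)
  have h7 : a - (∑ j ∈ Finset.range k, p ^ j • e (2 * j) + p ^ k • e (2 * k + 1)) -
      (a - (∑ j ∈ Finset.range k, p ^ j • e (2 * j) + p ^ k • e (2 * k))) =
      p ^ k • (e (2 * k) - e (2 * k + 1)) := by
    rw [smul_sub]
    abel
  rw [h7, hM.norm_pow_smul, pow_succ] at h6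
  have h8 := he.one_le_dist hM (Nat.ne_of_lt (Nat.lt_succ_self (2 * k)))
  rw [dist_eq_norm] at h8
  have h9 := le_of_mul_le_mul_left h6 (pow_pos (inv_prime_pos p) k)
  exact absurd (h8.trans h9) (not_le.2 (inv_prime_lt_one p))

lemma hasStronglySplittingSeq_of_le_aleph0 {κ : Cardinal.{u}} (hκ : κ ≤ ℵ₀) :
    HasStronglySplittingSeq (ofNormed M) lam κ := by
  obtain ⟨e, he⟩ := exists_pIndep_nat hM hmon hl
  obtain ⟨a, ha⟩ := exists_limit_sum hM fun j => e (2 * j)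
  -- The chain must be indexed by all ordinals; ordinal multiplication gives a monotone definition
  -- that is `{j | j < 2 * k}` at finite stages `k`.
  refine ⟨1, fun _ => a, fun i => e '' {j | ((j : ℕ) : Ordinal.{u}) < 2 * i}, fun i i' h => ?_,
    fun i hi => ⟨((to_countable _).image e).le_aleph0.trans_lt hl, ?_⟩⟩
  · refine image_mono fun j (hj : (j : Ordinal.{u}) < 2 * i) => ?_
    exact hj.trans_le (by gcongr)
  · have hω : i < Ordinal.omega0 := hi.trans_le (by
      rw [← ord_aleph0]
      exact ord_le_ord.2 hκ)
    obtain ⟨k, rfl⟩ := Ordinal.lt_omega0.1 hω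
    have h1 : ∀ m : ℕ, {j : ℕ | (j : Ordinal.{u}) < 2 * (m : Ordinal.{u})} = {j | j < 2 * m} := by
      intro m
      ext j
      have : (2 * (m : Ordinal.{u})) = ((2 * m : ℕ) : Ordinal.{u}) := by push_cast; rfl
      rw [mem_ofPred_eq, mem_ofPred_eq, this, Nat.cast_lt]
    have h2 : Order.succ (k : Ordinal.{u}) = ((k + 1 : ℕ) : Ordinal.{u}) := by
      push_cast
      rfl
    beta_reduce
    rw [h2, h1, h1]
    exact splitsStrongly_of_limit hM hmon hl he ha k

lemma aleph0_lt_kappa : ℵ₀ < kappa (ofNormed M) lam := by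
  have hne : {κ | ¬ HasStronglySplittingSeq (ofNormed M) lam κ}.Nonempty :=
    ⟨_, not_hasStronglySplittingSeq_succ⟩
  by_contra! h
  exact csInf_mem hne (hasStronglySplittingSeq_of_le_aleph0 hM hmon hl h)

/-- The base is a countable `C ⊆ A` whose closed pure hull contains the projection `ρ a`; the
realisation is `ρ a` plus a copy of `a - ρ a` that is free over `D`. -/
lemma simple : Simple (ofNormed M) lam := by
  intro n a A hA
  have hP := isPadic_pcl hM A
  obtain ⟨ρ, hρ⟩ := hP.exists_leftInverse hM (pcl p A).subtype (fun _ => rfl)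
  choose C hCA hCc hC using fun i => mem_pcl_countable (p := p) (ρ (a i)).2
  have hCu : ∀ i, (ρ (a i) : M) ∈ pcl p (⋃ i, C i) := fun i =>
    pcl_mono hM (subset_iUnion C i) (hC i)
  have hCA' : (⋃ i, C i) ⊆ A := iUnion_subset hCA
  refine ⟨⋃ i, C i, hCA', (countable_iUnion hCc).le_aleph0.trans_lt (aleph0_lt_kappa hM hmon hl),
    fun D hD hDc => ?_⟩
  rw [union_self] at hD ⊢
  let a' : Fin n → M := fun i => a i - ρ (a i)
  have hN := isPadic_pcl hM (range a')
  obtain ⟨h, hh⟩ := exists_free_hom hM hmon hl (isPadic_pcl hM D) (densityChar_pcl_lt hM hDc hl) hN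
    (densityChar_pcl_lt hM ((countable_range a').le_aleph0.trans_lt hl) hl)
  let y : Fin n → pcl p (range a') := fun i => ⟨a' i, subset_pcl _ ⟨i, rfl⟩⟩
  have hy : NormEq y a' := normEq_of_hom (pcl p (range a')).subtype (fun _ => rfl) fun _ => rfl
  refine ⟨fun i => (ρ (a i) : M) + h (y i), ?_, ?_⟩
  · refine (tg_eq_of_norm hM hmon hl hA fun c r hr => ?_).symm
    exact norm_zcomb_free hM hP hρ (pcl_mono hM hD) hh hy c (closure_le_pcl A hr)
  · rintro ⟨m, b, hb, hb0, hb1, hne⟩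
    obtain ⟨F, hF, hFC, hFb⟩ := hb.exists_map
    refine hne (tg_eq_of_norm hM hmon hl
      ((countable_iUnion hCc).le_aleph0.trans_lt hl) fun c r hr => ?_)
    set c₁ := (Finsupp.sumFinsuppAddEquivProdFinsupp c).1
    set c₂ := (Finsupp.sumFinsuppAddEquivProdFinsupp c).2
    -- Freeness over `D` separates the norm into a part inside `pcl p D` and a part that does not
    -- depend on `v`.
    have hsplit : ∀ v : Fin m → M, (∀ j, v j ∈ D) →
        ‖zcomb (Sum.elim (fun i => (ρ (a i) : M) + h (y i)) v) c + r‖ =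
          max ‖zcomb (fun i => (ρ (a i) : M)) c₁ + zcomb v c₂ + r‖ ‖zcomb y c₁‖ := by
      intro v hv
      rw [← hh, zcomb_sumElim, zcomb_add_family, map_zcomb' h (fun i => rfl)]
      · congr 1
        abel
      · refine add_mem (add_mem ?_ ?_) ?_
        · refine (AddSubgroup.closure_le (pcl p D)).2 ?_ (zcomb_mem_closure _ _)
          rintro _ ⟨i, rfl⟩
          exact pcl_mono hM hD (ρ (a i)).2
        · exact closure_le_pcl D
            (AddSubgroup.closure_mono (range_subset_iff.2 hv) (zcomb_mem_closure _ _))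
        · exact closure_le_pcl D (AddSubgroup.closure_mono (hCA'.trans hD) hr)
    refine (hsplit _ hb0).trans (Eq.trans ?_ (hsplit _ hb1).symm)
    congr 1
    -- The isometry `F` fixes `C`, hence its hull, which contains every `ρ (a i)`; so it carries the
    -- part with `b 1` to the part with `b 0`.
    have h1 : F (zcomb (fun i => (ρ (a i) : M)) c₁ + zcomb (b 1) c₂ + r) =
        zcomb (fun i => (ρ (a i) : M)) c₁ + zcomb (b 0) c₂ + r := by
      rw [map_add, map_add, map_zcomb' F hFb,
        map_zcomb' F (fun i => eq_of_mem_pcl hM hF hFC (hCu i)),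
        eq_of_mem_pcl hM hF hFC (closure_le_pcl _ hr)]
    rw [← h1, hF]

end

end Simplicity

end PadicMAEC

theorem proposition63 (p : ℕ) [Fact p.Prime] :
    PadicMAEC.IsMAEC (PadicMAEC.Kp.{u} p) ∧
    PadicMAEC.IsLSNumber (PadicMAEC.Kp.{u} p) Cardinal.aleph0 ∧
    PadicMAEC.JEP (PadicMAEC.Kp.{u} p) ∧
    PadicMAEC.AP (PadicMAEC.Kp.{u} p) ∧
    PadicMAEC.Homogeneous (PadicMAEC.Kp.{u} p) ∧
    (∀ lam : Cardinal.{u}, ∃ M, PadicMAEC.IsMonster (PadicMAEC.Kp.{u} p) lam M) ∧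
    ∀ (lam : Cardinal.{u}) (M : PadicMAEC.MetricStr.{u} PadicMAEC.groupLang),
      Cardinal.aleph0 < lam → PadicMAEC.IsMonster (PadicMAEC.Kp.{u} p) lam M →
        PadicMAEC.PerturbationProperty M ∧
        PadicMAEC.OmegaDPStable M ∧
        PadicMAEC.Simple M lam := by
  refine ⟨PadicMAEC.isMAEC_Kp p, PadicMAEC.isLSNumber_Kp p, PadicMAEC.jep_Kp p, PadicMAEC.ap_Kp p,
    PadicMAEC.homogeneous_Kp p, PadicMAEC.exists_monster p, fun lam M hl hmon => ?_⟩
  obtain ⟨M, _, hM, rfl⟩ := PadicMAEC.exists_ofNormed M hmon.mem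
  exact ⟨PadicMAEC.perturbationProperty hM hmon hl, PadicMAEC.omegaDPStable hM hmon hl,
    PadicMAEC.simple hM hmon hl⟩
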